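/- Let $d\in\{2,3\}$, let $\Omega\subset\mathbb R^d$ be a bounded Lipschitz domain, let $\mathcal T$ be a regular (conforming, simplicial) triangulation of $\Omega$, let $\kappa\in L_\infty(\Omega;\mathbb R^{d\times d})$ be symmetric and uniformly positive definite, and let $\beta\in\mathbb R^d$ be constant. Write $(\cdot,\cdot)$ and $\|\cdot\|$ for the $L_2(\Omega)$ inner product and norm (of scalar or vector functions), $(\cdot,\cdot)_{\mathcal T}:=\sum_{T\in\mathcal T}(\cdot,\cdot)_{L_2(T)}$, and $\|\tau\|_{\mathrm{div}}:=(\|\tau\|^2+\|\mathrm{div}\,\tau\|^2)^{1/2}$ for $\tau\in H(\mathrm{div},\Omega)$. Let $V:=H^1(\mathcal T):=\prod_{T\in\mathcal T}H^1(T)$ with norm $\|v\|_V:=\big(\sum_{T}(\|v\|_{L_2(T)}^2+\|\nabla v\|_{L_2(T)}^2)\big)^{1/2}$, and let $V^*$ be its topological dual with the operator norm. Define the normal trace operator $$\mathrm{trn}: H(\mathrm{div},\Omega)\to V^*,\qquad \langle \mathrm{trn}(\tau),v\rangle_{\mathcal S}:=(v,\mathrm{div}\,\tau)+(\nabla v,\tau)_{\mathcal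 T},$$ the space $H^{-1/2}(\mathcal S):=\mathrm{trn}(H(\mathrm{div},\Omega))$ with norm $\|\hat\sigma\|_{-1/2,\mathcal S}:=\inf\{\|\sigma\|_{\mathrm{div}}:\ \mathrm{trn}(\sigma)=\hat\sigma\}$, and $$U:=H^1_0(\Omega)\times H^{-1/2}(\mathcal S)\times L_2(\Omega)\times L_2(\Omega),\qquad \|(w,\hat\tau,s,t)\|_U:=\big(\|\nabla w\|^2+\|\hat\tau\|_{-1/2,\mathcal S}^2+\|s\|^2+\|t\|^2\big)^{1/2}.$$ Let $B:U\to V^*$ be the linear operator given by $$\langle B(u,\hat\sigma,q,r),v\rangle:=(\kappa\nabla u+q\beta,\nabla v)_{\mathcal T}-\langle\hat\sigma,v\rangle_{\mathcal S}+(r,v)\qquad(v\in V),$$ with kernel $\mathcal N(B)$. For $q,r\in L_2(\Omega)$ put $\mathcal E(q,r):=(u,\hat\sigma,q,r)$, where $u\in H^1_0(\Omega)$ solves $-\mathrm{div}\,\kappa\nabla u=\beta\cdot\nabla q-r$ in $H^{-1}(\Omega)=H^1_0(\Omega)^*$, that is, $(\kappa\nabla u,\nabla v)=-(q\beta,\nabla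 v)-(r,v)$ for all $v\in H^1_0(\Omega)$, and $\hat\sigma:=\mathrm{trn}(\kappa\nabla u+q\beta)$. **Proposition 2.2.** $\mathcal E$ is well defined and is a bounded linear operator $L_2(\Omega)\times L_2(\Omega)\to U$. Its image is the kernel of $B$: $\mathcal E(L_2(\Omega)\times L_2(\Omega))=\mathcal N(B)$. Moreover, $B$ induces an isomorphism (a linear homeomorphism) from $U/\mathcal N(B)$ onto $V^*$. -/

import Mathlib

open MeasureTheory TopologicalSpace Topology
open scoped Distributions ENNReal NNReal

noncomputable section

namespace DPG

/-- The Euclidean space `ℝ^d`. -/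
abbrev Space (d : ℕ) := EuclideanSpace ℝ (Fin d)

/-- A bounded Lipschitz domain in `ℝ^d`: a bounded, connected, non-empty open set which, near each
of its boundary points and in suitable orthonormal coordinates, is the set of points that lie
strictly above the graph of a Lipschitz function (`n` is the upward direction). -/
structure LipschitzDomain (d : ℕ) extends Opens (Space d) where
  isConnected : IsConnected carrier
  isBounded : Bornology.IsBounded carrier
  lipschitz_boundary : ∀ x ∈ frontier carrier, ∃ n : Space d, ‖n‖ = 1 ∧
    ∃ (K : ℝ≥0) (g : (Submodule.span ℝ {n})ᗮ → ℝ), LipschitzWith K g ∧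
      ∃ W : Set (Space d), IsOpen W ∧ x ∈ W ∧
        ∀ y ∈ W, y ∈ carrier ↔ g ((Submodule.span ℝ {n})ᗮ.orthogonalProjectionOnto y) < inner ℝ n y

/-- A regular (conforming, simplicial) triangulation of the domain `Ω`: a finite set of
non-degenerate closed `d`-simplices, given by their vertex sets, whose union is the closure of `Ω`
and any two of which intersect in the convex hull of their common vertices
(a common face, possibly empty). -/
structure Triangulation {d : ℕ} (Ω : LipschitzDomain d) where
  cells : Finset (Finset (Space d))
  card_eq : ∀ s ∈ cells, s.card = d + 1
  affineIndependent : ∀ s ∈ cells, AffineIndependent ℝ ((↑) : s → Space d)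
  iUnion_eq : ⋃ s ∈ cells, convexHull ℝ (s : Set (Space d)) = closure Ω.carrier
  inter_eq : ∀ s ∈ cells, ∀ t ∈ cells,
    convexHull ℝ (s : Set (Space d)) ∩ convexHull ℝ (t : Set (Space d)) =
      convexHull ℝ ((s : Set (Space d)) ∩ (t : Set (Space d)))

section Sobolev

variable {d : ℕ}

/-- `L_2(ω; F)`. -/
abbrev L2 (ω : Opens (Space d)) (F : Type) [NormedAddCommGroup F] : Type :=
  Lp F 2 (volume.restrict (ω : Set (Space d)))

/-- `g` is the weak gradient of `v` on `ω`: `∫ v ∂_e φ = - ∫ φ (g · e)` for all directions `e`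
and all test functions `φ ∈ C_c^∞(ω)`. -/
def IsWeakGradient (ω : Opens (Space d)) (v : L2 ω ℝ) (g : L2 ω (Space d)) : Prop :=
  ∀ (φ : 𝓓(ω, ℝ)) (e : Space d),
    ∫ x in (ω : Set (Space d)), v x * fderiv ℝ φ x e =
      - ∫ x in (ω : Set (Space d)), φ x * inner ℝ (g x) e

/-- `δ` is the weak divergence of `τ` on `ω`: `∫ τ · ∇φ = - ∫ δ φ` for all test functions
`φ ∈ C_c^∞(ω)`. -/
def IsWeakDivergence (ω : Opens (Space d)) (τ : L2 ω (Space d)) (δ : L2 ω ℝ) : Prop :=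
  ∀ φ : 𝓓(ω, ℝ),
    ∫ x in (ω : Set (Space d)), inner ℝ (τ x) (gradient φ x) =
      - ∫ x in (ω : Set (Space d)), δ x * φ x

lemma memLp_test {ω : Opens (Space d)} (φ : 𝓓(ω, ℝ)) :
    MemLp (fun x => φ x) 2 (volume.restrict (ω : Set (Space d))) :=
  (φ.continuous.memLp_of_hasCompactSupport φ.hasCompactSupport).restrict _

lemma continuous_fderiv_test {ω : Opens (Space d)} (φ : 𝓓(ω, ℝ)) :
    Continuous (fderiv ℝ (fun x => φ x)) :=
  φ.contDiff.continuous_fderiv (by simp)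

lemma memLp_gradient_test {ω : Opens (Space d)} (φ : 𝓓(ω, ℝ)) :
    MemLp (gradient (fun x => φ x)) 2 (volume.restrict (ω : Set (Space d))) := by
  refine (Continuous.memLp_of_hasCompactSupport ?_ ?_).restrict _
  · exact (InnerProductSpace.toDual ℝ (Space d)).symm.continuous.comp (continuous_fderiv_test φ)
  · exact (φ.hasCompactSupport.fderiv ℝ).comp_left (map_zero _)

lemma memLp_fderiv_test {ω : Opens (Space d)} (φ : 𝓓(ω, ℝ)) (e : Space d) :
    MemLp (fun x => fderiv ℝ φ x e) 2 (volume.restrict (ω : Set (Space d))) := by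
  refine (Continuous.memLp_of_hasCompactSupport ?_ ?_).restrict _
  · exact (continuous_fderiv_test φ).clm_apply continuous_const
  · exact (φ.hasCompactSupport.fderiv ℝ).comp_left (g := fun L : Space d →L[ℝ] ℝ => L e) rfl

/-- `H^1(ω)`, as the space of all pairs `(v, ∇v)` of `L_2` functions and `L_2` weak gradients.
Its norm is the one inherited from the Hilbert sum `L_2(ω) ⊕ L_2(ω; ℝ^d)`, that is,
`(‖v‖² + ‖∇v‖²)^{1/2}`. -/
def H1 (ω : Opens (Space d)) : Submodule ℝ (WithLp 2 (L2 ω ℝ × L2 ω (Space d))) where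
  carrier := {w | IsWeakGradient ω w.fst w.snd}
  zero_mem' := by
    intro φ e
    have h1 : ∀ᵐ x ∂(volume.restrict (ω : Set (Space d))), (0 : L2 ω ℝ) x = 0 :=
      Lp.coeFn_zero _ _ _
    have h2 : ∀ᵐ x ∂(volume.restrict (ω : Set (Space d))), (0 : L2 ω (Space d)) x = 0 :=
      Lp.coeFn_zero _ _ _
    rw [integral_eq_zero_of_ae, integral_eq_zero_of_ae, neg_zero]
    · filter_upwards [h2] with x hx
      change φ x * inner ℝ ((0 : L2 ω (Space d)) x) e = 0
      rw [hx, inner_zero_left, mul_zero]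
    · filter_upwards [h1] with x hx
      change (0 : L2 ω ℝ) x * fderiv ℝ φ x e = 0
      rw [hx, zero_mul]
  add_mem' := by
    intro a b ha hb φ e
    have i1 : ∀ v : L2 ω ℝ, Integrable (fun x => v x * fderiv ℝ φ x e)
        (volume.restrict (ω : Set (Space d))) :=
      fun v => (Lp.memLp v).integrable_mul (memLp_fderiv_test φ e)
    have i2 : ∀ g : L2 ω (Space d), Integrable (fun x => φ x * inner ℝ (g x) e)
        (volume.restrict (ω : Set (Space d))) :=
      fun g => (memLp_test φ).integrable_mul ((Lp.memLp g).inner_const (𝕜 := ℝ) e)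
    have e1 : ∫ x in (ω : Set (Space d)), (a + b).fst x * fderiv ℝ φ x e =
        (∫ x in (ω : Set (Space d)), a.fst x * fderiv ℝ φ x e) +
          ∫ x in (ω : Set (Space d)), b.fst x * fderiv ℝ φ x e := by
      rw [← integral_add (i1 _) (i1 _)]
      refine integral_congr_ae ?_
      filter_upwards [Lp.coeFn_add a.fst b.fst] with x hx
      rw [WithLp.add_fst, hx, Pi.add_apply, add_mul]
    have e2 : ∫ x in (ω : Set (Space d)), φ x * inner ℝ ((a + b).snd x) e =
        (∫ x in (ω : Set (Space d)), φ x * inner ℝ (a.snd x) e) +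
          ∫ x in (ω : Set (Space d)), φ x * inner ℝ (b.snd x) e := by
      rw [← integral_add (i2 _) (i2 _)]
      refine integral_congr_ae ?_
      filter_upwards [Lp.coeFn_add a.snd b.snd] with x hx
      rw [WithLp.add_snd, hx, Pi.add_apply, inner_add_left, mul_add]
    rw [e1, e2, ha φ e, hb φ e]
    ring
  smul_mem' := by
    intro c a ha φ e
    have e1 : ∫ x in (ω : Set (Space d)), (c • a).fst x * fderiv ℝ φ x e =
        c * ∫ x in (ω : Set (Space d)), a.fst x * fderiv ℝ φ x e := by
      rw [← integral_const_mul]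
      refine integral_congr_ae ?_
      filter_upwards [Lp.coeFn_smul c a.fst] with x hx
      rw [WithLp.smul_fst, hx, Pi.smul_apply, smul_eq_mul, mul_assoc]
    have e2 : ∫ x in (ω : Set (Space d)), φ x * inner ℝ ((c • a).snd x) e =
        c * ∫ x in (ω : Set (Space d)), φ x * inner ℝ (a.snd x) e := by
      rw [← integral_const_mul]
      refine integral_congr_ae ?_
      filter_upwards [Lp.coeFn_smul c a.snd] with x hx
      rw [WithLp.smul_snd, hx, Pi.smul_apply, real_inner_smul_left]
      ring
    rw [e1, e2, ha φ e]
    ring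

/-- The function `v` of an element `v` of `H^1(ω)`. -/
def H1.val (ω : Opens (Space d)) : H1 ω →L[ℝ] L2 ω ℝ :=
  (WithLp.fstL 2 ℝ _ _).comp (H1 ω).subtypeL

/-- The gradient `∇v` of an element `v` of `H^1(ω)`. -/
def H1.grad (ω : Opens (Space d)) : H1 ω →L[ℝ] L2 ω (Space d) :=
  (WithLp.sndL 2 ℝ _ _).comp (H1 ω).subtypeL

/-- `C_c^∞(ω)` as a subspace of `H^1(ω)`. -/
def testSubmodule (ω : Opens (Space d)) : Submodule ℝ (H1 ω) where
  carrier := {w | ∃ φ : 𝓓(ω, ℝ), ∀ᵐ x ∂(volume.restrict (ω : Set (Space d))), H1.val ω w x = φ x}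
  zero_mem' := by
    refine ⟨0, ?_⟩
    rw [map_zero]
    filter_upwards [Lp.coeFn_zero ℝ 2 (volume.restrict (ω : Set (Space d)))] with x hx
    rw [hx]
    rfl
  add_mem' := by
    rintro a b ⟨φ, hφ⟩ ⟨ψ, hψ⟩
    refine ⟨φ + ψ, ?_⟩
    rw [map_add]
    filter_upwards [Lp.coeFn_add (H1.val ω a) (H1.val ω b), hφ, hψ] with x hx h1 h2
    rw [hx, Pi.add_apply, h1, h2]
    rfl
  smul_mem' := by
    rintro c a ⟨φ, hφ⟩
    refine ⟨c • φ, ?_⟩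
    rw [map_smul]
    filter_upwards [Lp.coeFn_smul c (H1.val ω a), hφ] with x hx h1
    rw [hx, Pi.smul_apply, h1]
    rfl

/-- `H^1_0(ω)`: the closure of `C_c^∞(ω)` in `H^1(ω)`. -/
def H10 (ω : Opens (Space d)) : Submodule ℝ (H1 ω) := (testSubmodule ω).topologicalClosure

/-- The function of an element of `H^1_0(ω)`. -/
def H10.val (ω : Opens (Space d)) : H10 ω →ₗ[ℝ] L2 ω ℝ :=
  (H1.val ω).toLinearMap ∘ₗ (H10 ω).subtype

/-- The gradient of an element of `H^1_0(ω)`. -/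
def H10.grad (ω : Opens (Space d)) : H10 ω →ₗ[ℝ] L2 ω (Space d) :=
  (H1.grad ω).toLinearMap ∘ₗ (H10 ω).subtype

/-- `H(div, ω)`, as the space of all pairs `(τ, div τ)` of `L_2` vector fields and `L_2` weak
divergences. Its norm is the one inherited from the Hilbert sum `L_2(ω; ℝ^d) ⊕ L_2(ω)`, that is,
`‖τ‖_div = (‖τ‖² + ‖div τ‖²)^{1/2}`. -/
def HDiv (ω : Opens (Space d)) : Submodule ℝ (WithLp 2 (L2 ω (Space d) × L2 ω ℝ)) where
  carrier := {w | IsWeakDivergence ω w.fst w.snd}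
  zero_mem' := by
    intro φ
    have h1 : ∀ᵐ x ∂(volume.restrict (ω : Set (Space d))), (0 : L2 ω ℝ) x = 0 :=
      Lp.coeFn_zero _ _ _
    have h2 : ∀ᵐ x ∂(volume.restrict (ω : Set (Space d))), (0 : L2 ω (Space d)) x = 0 :=
      Lp.coeFn_zero _ _ _
    rw [integral_eq_zero_of_ae, integral_eq_zero_of_ae, neg_zero]
    · filter_upwards [h1] with x hx
      change (0 : L2 ω ℝ) x * φ x = 0
      rw [hx, zero_mul]
    · filter_upwards [h2] with x hx
      change inner ℝ ((0 : L2 ω (Space d)) x) (gradient φ x) = 0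
      rw [hx, inner_zero_left]
  add_mem' := by
    intro a b ha hb φ
    have i1 : ∀ v : L2 ω ℝ, Integrable (fun x => v x * φ x)
        (volume.restrict (ω : Set (Space d))) :=
      fun v => (Lp.memLp v).integrable_mul (memLp_test φ)
    have i2 : ∀ g : L2 ω (Space d),
        Integrable (fun x => inner ℝ (g x) (gradient (fun x => φ x) x))
          (volume.restrict (ω : Set (Space d))) := fun g => by
      refine (L2.integrable_inner (𝕜 := ℝ) g ((memLp_gradient_test φ).toLp _)).congr ?_
      filter_upwards [(memLp_gradient_test φ).coeFn_toLp] with x hx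
      rw [hx]
    have e1 : ∫ x in (ω : Set (Space d)), (a + b).snd x * φ x =
        (∫ x in (ω : Set (Space d)), a.snd x * φ x) +
          ∫ x in (ω : Set (Space d)), b.snd x * φ x := by
      rw [← integral_add (i1 _) (i1 _)]
      refine integral_congr_ae ?_
      filter_upwards [Lp.coeFn_add a.snd b.snd] with x hx
      rw [WithLp.add_snd, hx, Pi.add_apply, add_mul]
    have e2 : ∫ x in (ω : Set (Space d)), inner ℝ ((a + b).fst x) (gradient φ x) =
        (∫ x in (ω : Set (Space d)), inner ℝ (a.fst x) (gradient φ x)) +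
          ∫ x in (ω : Set (Space d)), inner ℝ (b.fst x) (gradient φ x) := by
      rw [← integral_add (i2 _) (i2 _)]
      refine integral_congr_ae ?_
      filter_upwards [Lp.coeFn_add a.fst b.fst] with x hx
      rw [WithLp.add_fst, hx, Pi.add_apply, inner_add_left]
    rw [e1, e2, ha φ, hb φ]
    ring
  smul_mem' := by
    intro c a ha φ
    have e1 : ∫ x in (ω : Set (Space d)), (c • a).snd x * φ x =
        c * ∫ x in (ω : Set (Space d)), a.snd x * φ x := by
      rw [← integral_const_mul]
      refine integral_congr_ae ?_
      filter_upwards [Lp.coeFn_smul c a.snd] with x hx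
      rw [WithLp.smul_snd, hx, Pi.smul_apply, smul_eq_mul, mul_assoc]
    have e2 : ∫ x in (ω : Set (Space d)), inner ℝ ((c • a).fst x) (gradient φ x) =
        c * ∫ x in (ω : Set (Space d)), inner ℝ (a.fst x) (gradient φ x) := by
      rw [← integral_const_mul]
      refine integral_congr_ae ?_
      filter_upwards [Lp.coeFn_smul c a.fst] with x hx
      rw [WithLp.smul_fst, hx, Pi.smul_apply, real_inner_smul_left]
    rw [e1, e2, ha φ]
    ring

/-- The vector field `τ` of an element `τ` of `H(div, ω)`. -/
def HDiv.val (ω : Opens (Space d)) : HDiv ω →L[ℝ] L2 ω (Space d) :=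
  (WithLp.fstL 2 ℝ _ _).comp (HDiv ω).subtypeL

/-- The divergence `div τ` of an element `τ` of `H(div, ω)`. -/
def HDiv.div (ω : Opens (Space d)) : HDiv ω →L[ℝ] L2 ω ℝ :=
  (WithLp.sndL 2 ℝ _ _).comp (HDiv ω).subtypeL

/-- Restriction `L_2(ω'; F) → L_2(ω; F)` for `ω ⊆ ω'`. -/
def restrictL2 (F : Type) [NormedAddCommGroup F] [NormedSpace ℝ F] {ω ω' : Opens (Space d)}
    (h : ω ≤ ω') : L2 ω' F →ₗ[ℝ] L2 ω F where
  toFun f := ((Lp.memLp f).mono_measure (Measure.restrict_mono h le_rfl)).toLp f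
  map_add' f g := by
    rw [← MemLp.toLp_add]
    refine MemLp.toLp_congr _ _ ?_
    exact ae_mono (Measure.restrict_mono h le_rfl) (Lp.coeFn_add f g)
  map_smul' c f := by
    rw [RingHom.id_apply, ← MemLp.toLp_const_smul]
    refine MemLp.toLp_congr _ _ ?_
    exact ae_mono (Measure.restrict_mono h le_rfl) (Lp.coeFn_smul c f)

end Sobolev

section Mesh

variable {d : ℕ} {Ω : LipschitzDomain d}

/-- A Lipschitz domain is the interior of its closure. -/
lemma LipschitzDomain.interior_closure_subset (Ω : LipschitzDomain d) :
    interior (closure Ω.carrier) ⊆ Ω.carrier := by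
  intro x hx
  by_contra hxΩ
  have hxf : x ∈ frontier Ω.carrier := by
    refine ⟨interior_subset hx, ?_⟩
    rw [Ω.is_open'.interior_eq]
    exact hxΩ
  obtain ⟨n, hn, K, g, hg, W, hW, hxW, hgr⟩ := Ω.lipschitz_boundary x hxf
  set P := (Submodule.span ℝ {n})ᗮ.orthogonalProjectionOnto with hP
  have hPn : P n = 0 := by
    rw [hP, Submodule.orthogonalProjectionOnto_eq_zero_iff]
    exact Submodule.le_orthogonal_orthogonal _ (Submodule.mem_span_singleton_self n)
  have hxle : inner ℝ n x ≤ g (P x) := not_lt.1 fun h => hxΩ ((hgr x hxW).2 h)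
  -- move down from `x` inside the open set `W ∩ interior (closure Ω)`
  have hcont : Continuous fun t : ℝ => x - t • n := by fun_prop
  have hmem : ∀ᶠ t in 𝓝 (0 : ℝ), x - t • n ∈ W ∩ interior (closure Ω.carrier) :=
    hcont.continuousAt.eventually_mem ((hW.inter isOpen_interior).mem_nhds (by simpa using ⟨hxW, hx⟩))
  obtain ⟨t, ht, htpos⟩ :=
    ((hmem.filter_mono nhdsWithin_le_nhds).and
      (self_mem_nhdsWithin : Set.Ioi (0 : ℝ) ∈ 𝓝[>] (0 : ℝ))).exists
  have htpos : 0 < t := htpos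
  set y := x - t • n with hy
  have hylt : inner ℝ n y < g (P y) := by
    have h1 : P y = P x := by simp [hy, hPn]
    have h2 : inner ℝ n y = inner ℝ n x - t := by
      rw [hy, inner_sub_right, inner_smul_right, real_inner_self_eq_norm_sq, hn]
      ring
    rw [h1, h2]
    linarith
  have hopen : IsOpen (W ∩ {z | inner ℝ n z < g (P z)}) :=
    hW.inter (isOpen_lt (by fun_prop) (hg.continuous.comp P.continuous))
  obtain ⟨z, ⟨hzW, hz⟩, hzΩ⟩ :=
    mem_closure_iff.1 (interior_subset ht.2) _ hopen ⟨ht.1, hylt⟩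
  exact lt_asymm hz ((hgr z hzW).1 hzΩ)

/-- The open element `T` with vertex set `s`. -/
def element (s : Finset (Space d)) : Opens (Space d) :=
  ⟨interior (convexHull ℝ (s : Set (Space d))), isOpen_interior⟩

lemma Triangulation.element_le (𝒯 : Triangulation Ω) (T : 𝒯.cells) :
    element T.1 ≤ Ω.toOpens := by
  refine Set.Subset.trans (interior_mono ?_) Ω.interior_closure_subset
  rw [← 𝒯.iUnion_eq]
  exact Set.subset_biUnion_of_mem (u := fun s : Finset (Space d) =>
    convexHull ℝ (s : Set (Space d))) T.2

/-- The test space `V = H^1(𝒯) = Π_T H^1(T)`, a product of Hilbert spaces, with norm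
`(∑_T ‖v‖²_{1,T})^{1/2}`. -/
abbrev TestSpace (𝒯 : Triangulation Ω) : Type :=
  PiLp 2 fun T : 𝒯.cells => H1 (element T.1)

/-- The topological dual `V^*` with its operator norm. -/
abbrev TestDual (𝒯 : Triangulation Ω) : Type := TestSpace 𝒯 →L[ℝ] ℝ

/-- The functional `v ↦ (f, v) = ∑_T ∫_T f v` on `V`, for `f ∈ L_2(Ω)`. -/
def pairVal (𝒯 : Triangulation Ω) : L2 Ω.toOpens ℝ →ₗ[ℝ] TestDual 𝒯 :=
  ∑ T : 𝒯.cells,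
    { toFun := fun f =>
        (innerSL ℝ (restrictL2 ℝ (𝒯.element_le T) f)).comp
          ((H1.val (element T.1)).comp (PiLp.proj 2 (fun T : 𝒯.cells => H1 (element T.1)) T))
      map_add' := fun f g => by ext v; simp
      map_smul' := fun c f => by ext v; simp }

/-- The functional `v ↦ (τ, ∇v)_𝒯 = ∑_T ∫_T τ · ∇v` on `V`, for `τ ∈ L_2(Ω; ℝ^d)`. -/
def pairGrad (𝒯 : Triangulation Ω) : L2 Ω.toOpens (Space d) →ₗ[ℝ] TestDual 𝒯 :=
  ∑ T : 𝒯.cells,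
    { toFun := fun τ =>
        (innerSL ℝ (restrictL2 (Space d) (𝒯.element_le T) τ)).comp
          ((H1.grad (element T.1)).comp (PiLp.proj 2 (fun T : 𝒯.cells => H1 (element T.1)) T))
      map_add' := fun f g => by ext v; simp
      map_smul' := fun c f => by ext v; simp }

lemma pairVal_apply (𝒯 : Triangulation Ω) (f : L2 Ω.toOpens ℝ) (v : TestSpace 𝒯) :
    pairVal 𝒯 f v = ∑ T : 𝒯.cells, ∫ x in (element T.1 : Set (Space d)),
      f x * H1.val (element T.1) (v T) x := by
  simp only [pairVal, LinearMap.sum_apply, LinearMap.coe_mk, AddHom.coe_mk,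
    _root_.sum_apply, ContinuousLinearMap.comp_apply, innerSL_apply_apply,
    L2.inner_def, PiLp.proj_apply]
  refine Finset.sum_congr rfl fun T _ => integral_congr_ae ?_
  filter_upwards [((Lp.memLp f).mono_measure
    (Measure.restrict_mono (𝒯.element_le T) le_rfl)).coeFn_toLp] with x hx
  simp [restrictL2, hx, mul_comm]

lemma pairGrad_apply (𝒯 : Triangulation Ω) (τ : L2 Ω.toOpens (Space d)) (v : TestSpace 𝒯) :
    pairGrad 𝒯 τ v = ∑ T : 𝒯.cells, ∫ x in (element T.1 : Set (Space d)),
      inner ℝ (τ x) (H1.grad (element T.1) (v T) x) := by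
  simp only [pairGrad, LinearMap.sum_apply, LinearMap.coe_mk, AddHom.coe_mk,
    _root_.sum_apply, ContinuousLinearMap.comp_apply, innerSL_apply_apply,
    L2.inner_def, PiLp.proj_apply]
  refine Finset.sum_congr rfl fun T _ => integral_congr_ae ?_
  filter_upwards [((Lp.memLp τ).mono_measure
    (Measure.restrict_mono (𝒯.element_le T) le_rfl)).coeFn_toLp] with x hx
  simp [restrictL2, hx]

/-- The normal trace operator `trn : H(div, Ω) → H^1(𝒯)^*`,
`⟨trn τ, v⟩_𝒮 = (v, div τ) + (∇v, τ)_𝒯`. -/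
def trn (𝒯 : Triangulation Ω) : HDiv Ω.toOpens →ₗ[ℝ] TestDual 𝒯 :=
  pairVal 𝒯 ∘ₗ (HDiv.div Ω.toOpens).toLinearMap +
    pairGrad 𝒯 ∘ₗ (HDiv.val Ω.toOpens).toLinearMap

/-- `H^{-1/2}(𝒮) = trn (H(div, Ω))`, a subspace of `H^1(𝒯)^*`. -/
def Trace (𝒯 : Triangulation Ω) : Submodule ℝ (TestDual 𝒯) := LinearMap.range (trn 𝒯)

/-- The canonical trace norm `‖σ‖_{-1/2,𝒮} = inf {‖τ‖_div ; trn τ = σ}`. -/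
def traceNorm (𝒯 : Triangulation Ω) (σ : Trace 𝒯) : ℝ :=
  sInf {c : ℝ | ∃ τ : HDiv Ω.toOpens, trn 𝒯 τ = σ ∧ c = ‖τ‖}

/-- The trial space `U = H^1_0(Ω) × H^{-1/2}(𝒮) × L_2(Ω) × L_2(Ω)`. (It is a type of its own, so
that it does not inherit the maximum norm of the product.) -/
def TrialSpace (𝒯 : Triangulation Ω) : Type :=
  H10 Ω.toOpens × Trace 𝒯 × L2 Ω.toOpens ℝ × L2 Ω.toOpens ℝ

instance (𝒯 : Triangulation Ω) : AddCommGroup (TrialSpace 𝒯) :=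
  inferInstanceAs (AddCommGroup (H10 Ω.toOpens × Trace 𝒯 × L2 Ω.toOpens ℝ × L2 Ω.toOpens ℝ))

instance (𝒯 : Triangulation Ω) : Module ℝ (TrialSpace 𝒯) :=
  inferInstanceAs (Module ℝ (H10 Ω.toOpens × Trace 𝒯 × L2 Ω.toOpens ℝ × L2 Ω.toOpens ℝ))

namespace TrialSpace

variable (𝒯 : Triangulation Ω)

/-- The component `u ∈ H^1_0(Ω)` of `(u, σ, q, r) ∈ U`. -/
def u : TrialSpace 𝒯 →ₗ[ℝ] H10 Ω.toOpens := LinearMap.fst ℝ _ _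

/-- The component `σ ∈ H^{-1/2}(𝒮)` of `(u, σ, q, r) ∈ U`. -/
def σ : TrialSpace 𝒯 →ₗ[ℝ] Trace 𝒯 :=
  LinearMap.fst ℝ _ (L2 Ω.toOpens ℝ × L2 Ω.toOpens ℝ) ∘ₗ
    LinearMap.snd ℝ (H10 Ω.toOpens) (Trace 𝒯 × L2 Ω.toOpens ℝ × L2 Ω.toOpens ℝ)

/-- The component `q ∈ L_2(Ω)` of `(u, σ, q, r) ∈ U`. -/
def q : TrialSpace 𝒯 →ₗ[ℝ] L2 Ω.toOpens ℝ :=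
  LinearMap.fst ℝ _ (L2 Ω.toOpens ℝ) ∘ₗ LinearMap.snd ℝ (Trace 𝒯) _ ∘ₗ
    LinearMap.snd ℝ (H10 Ω.toOpens) (Trace 𝒯 × L2 Ω.toOpens ℝ × L2 Ω.toOpens ℝ)

/-- The component `r ∈ L_2(Ω)` of `(u, σ, q, r) ∈ U`. -/
def r : TrialSpace 𝒯 →ₗ[ℝ] L2 Ω.toOpens ℝ :=
  LinearMap.snd ℝ (L2 Ω.toOpens ℝ) _ ∘ₗ LinearMap.snd ℝ (Trace 𝒯) _ ∘ₗ
    LinearMap.snd ℝ (H10 Ω.toOpens) (Trace 𝒯 × L2 Ω.toOpens ℝ × L2 Ω.toOpens ℝ)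

/-- `‖(w, σ, s, t)‖_U = (‖∇w‖² + ‖σ‖²_{-1/2,𝒮} + ‖s‖² + ‖t‖²)^{1/2}`. -/
instance : Norm (TrialSpace 𝒯) where
  norm w := √(‖H10.grad Ω.toOpens (u 𝒯 w)‖ ^ 2 + traceNorm 𝒯 (σ 𝒯 w) ^ 2 +
    ‖q 𝒯 w‖ ^ 2 + ‖r 𝒯 w‖ ^ 2)

lemma norm_def (w : TrialSpace 𝒯) :
    ‖w‖ = √(‖H10.grad Ω.toOpens (u 𝒯 w)‖ ^ 2 + traceNorm 𝒯 (σ 𝒯 w) ^ 2 +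
      ‖q 𝒯 w‖ ^ 2 + ‖r 𝒯 w‖ ^ 2) := rfl

end TrialSpace

lemma traceNorm_nonneg (𝒯 : Triangulation Ω) (σ : Trace 𝒯) : 0 ≤ traceNorm 𝒯 σ := by
  refine Real.sInf_nonneg ?_
  rintro _ ⟨τ, -, rfl⟩
  exact norm_nonneg τ

lemma traceNorm_le (𝒯 : Triangulation Ω) (σ : Trace 𝒯) (τ : HDiv Ω.toOpens)
    (h : trn 𝒯 τ = σ) : traceNorm 𝒯 σ ≤ ‖τ‖ := by
  refine csInf_le ⟨0, ?_⟩ ⟨τ, h, rfl⟩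
  rintro _ ⟨τ, -, rfl⟩
  exact norm_nonneg τ

lemma exists_lt_of_traceNorm_lt (𝒯 : Triangulation Ω) (σ : Trace 𝒯) {c : ℝ}
    (h : traceNorm 𝒯 σ < c) : ∃ τ : HDiv Ω.toOpens, trn 𝒯 τ = σ ∧ ‖τ‖ < c := by
  obtain ⟨τ₀, h₀⟩ := σ.2
  have hne : {c : ℝ | ∃ τ : HDiv Ω.toOpens, trn 𝒯 τ = σ ∧ c = ‖τ‖}.Nonempty := ⟨‖τ₀‖, τ₀, h₀, rfl⟩
  obtain ⟨_, ⟨τ, hτ, rfl⟩, hc⟩ := exists_lt_of_csInf_lt hne h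
  exact ⟨τ, hτ, hc⟩

lemma traceNorm_add_le (𝒯 : Triangulation Ω) (σ ρ : Trace 𝒯) :
    traceNorm 𝒯 (σ + ρ) ≤ traceNorm 𝒯 σ + traceNorm 𝒯 ρ := by
  refine le_of_forall_pos_lt_add fun ε hε => ?_
  obtain ⟨a, ha, ha'⟩ := exists_lt_of_traceNorm_lt 𝒯 σ (lt_add_of_pos_right _ (half_pos hε))
  obtain ⟨b, hb, hb'⟩ := exists_lt_of_traceNorm_lt 𝒯 ρ (lt_add_of_pos_right _ (half_pos hε))
  have h1 := traceNorm_le 𝒯 (σ + ρ) (a + b) (by simp [ha, hb])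
  have h2 := norm_add_le a b
  linarith

lemma traceNorm_smul_le (𝒯 : Triangulation Ω) (c : ℝ) (σ : Trace 𝒯) :
    traceNorm 𝒯 (c • σ) ≤ |c| * traceNorm 𝒯 σ := by
  refine le_of_forall_pos_lt_add fun ε hε => ?_
  have hc : 0 < |c| + 1 := by positivity
  obtain ⟨a, ha, ha'⟩ :=
    exists_lt_of_traceNorm_lt 𝒯 σ (lt_add_of_pos_right _ (div_pos hε hc))
  have h1 := traceNorm_le 𝒯 (c • σ) (c • a) (by simp [ha])
  rw [norm_smul, Real.norm_eq_abs] at h1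
  have h2 : |c| * ‖a‖ ≤ |c| * (traceNorm 𝒯 σ + ε / (|c| + 1)) :=
    mul_le_mul_of_nonneg_left ha'.le (abs_nonneg c)
  have h3 : |c| * (ε / (|c| + 1)) < ε := by
    rw [← mul_div_assoc, div_lt_iff₀ hc]
    nlinarith
  linarith

lemma traceNorm_smul (𝒯 : Triangulation Ω) (c : ℝ) (σ : Trace 𝒯) :
    traceNorm 𝒯 (c • σ) = |c| * traceNorm 𝒯 σ := by
  refine le_antisymm (traceNorm_smul_le 𝒯 c σ) ?_
  rcases eq_or_ne c 0 with rfl | hc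
  · simpa using traceNorm_nonneg 𝒯 _
  · have h := traceNorm_smul_le 𝒯 c⁻¹ (c • σ)
    rw [smul_smul, inv_mul_cancel₀ hc, one_smul, abs_inv] at h
    rwa [le_inv_mul_iff₀ (abs_pos.2 hc)] at h

lemma sqrt_add_four_le {a b c e a' b' c' e' A B C D : ℝ} (hA : 0 ≤ A) (hB : 0 ≤ B) (hC : 0 ≤ C)
    (hD : 0 ≤ D) (h1 : A ≤ a + a') (h2 : B ≤ b + b') (h3 : C ≤ c + c') (h4 : D ≤ e + e') :
    √(A ^ 2 + B ^ 2 + C ^ 2 + D ^ 2) ≤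
      √(a ^ 2 + b ^ 2 + c ^ 2 + e ^ 2) + √(a' ^ 2 + b' ^ 2 + c' ^ 2 + e' ^ 2) := by
  have key := norm_add_le (!₂[a, b, c, e] : EuclideanSpace ℝ (Fin 4)) !₂[a', b', c', e']
  simp only [EuclideanSpace.norm_eq, Fin.sum_univ_four, Real.norm_eq_abs, sq_abs] at key
  refine le_trans (Real.sqrt_le_sqrt ?_) (by simpa using key)
  gcongr

lemma TrialSpace.core (𝒯 : Triangulation Ω) : SeminormedSpace.Core ℝ (TrialSpace 𝒯) where
  norm_nonneg w := Real.sqrt_nonneg _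
  norm_smul c w := by
    rw [TrialSpace.norm_def, TrialSpace.norm_def]
    simp only [map_smul, norm_smul, traceNorm_smul, Real.norm_eq_abs]
    rw [← Real.sqrt_sq (abs_nonneg c), ← Real.sqrt_mul (sq_nonneg _),
      Real.sqrt_sq (abs_nonneg c)]
    congr 1
    ring
  norm_triangle v w := by
    rw [TrialSpace.norm_def, TrialSpace.norm_def, TrialSpace.norm_def]
    simp only [map_add]
    exact sqrt_add_four_le (norm_nonneg _) (traceNorm_nonneg 𝒯 _) (norm_nonneg _) (norm_nonneg _)
      (norm_add_le _ _) (traceNorm_add_le 𝒯 _ _) (norm_add_le _ _) (norm_add_le _ _)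

instance (𝒯 : Triangulation Ω) : SeminormedAddCommGroup (TrialSpace 𝒯) :=
  SeminormedAddCommGroup.ofCore (TrialSpace.core 𝒯)

instance (𝒯 : Triangulation Ω) : NormedSpace ℝ (TrialSpace 𝒯) where
  norm_smul_le c w := ((TrialSpace.core 𝒯).norm_smul c w).le

end Mesh

section Operators

variable {d : ℕ} {Ω : LipschitzDomain d}

/-- `L_∞(Ω; ℝ^{d×d})`; matrices are identified with the linear maps of `ℝ^d`. -/
abbrev Coefficient (Ω : LipschitzDomain d) : Type :=
  Lp (Space d →L[ℝ] Space d) ∞ (volume.restrict (Ω.carrier : Set (Space d)))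

/-- `κ(x)` is symmetric for almost all `x ∈ Ω`. -/
def Coefficient.IsSymm (κ : Coefficient Ω) : Prop :=
  ∀ᵐ x ∂(volume.restrict Ω.carrier), ∀ ξ η : Space d, inner ℝ (κ x ξ) η = inner ℝ ξ (κ x η)

/-- `κ` is uniformly positive definite on `Ω`. -/
def Coefficient.IsUniformlyPosDef (κ : Coefficient Ω) : Prop :=
  ∃ α : ℝ, 0 < α ∧ ∀ᵐ x ∂(volume.restrict Ω.carrier), ∀ ξ : Space d,
    α * ‖ξ‖ ^ 2 ≤ inner ℝ (κ x ξ) ξ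

/-- The multiplication operator `τ ↦ κ τ` on `L_2(Ω; ℝ^d)`. -/
def mulCoeff (κ : Coefficient Ω) : L2 Ω.toOpens (Space d) →L[ℝ] L2 Ω.toOpens (Space d) :=
  (ContinuousLinearMap.id ℝ (Space d →L[ℝ] Space d)).holderL
    (volume.restrict Ω.carrier) ∞ 2 2 κ

lemma mulCoeff_ae (κ : Coefficient Ω) (τ : L2 Ω.toOpens (Space d)) :
    ∀ᵐ x ∂(volume.restrict Ω.carrier), mulCoeff κ τ x = κ x (τ x) :=
  (ContinuousLinearMap.id ℝ (Space d →L[ℝ] Space d)).coeFn_holder κ τ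

/-- The operator `q ↦ q β` from `L_2(Ω)` to `L_2(Ω; ℝ^d)`. -/
def mulVec (Ω : LipschitzDomain d) (β : Space d) : L2 Ω.toOpens ℝ →L[ℝ] L2 Ω.toOpens (Space d) :=
  (ContinuousLinearMap.toSpanSingleton ℝ β).compLpL 2 (volume.restrict Ω.carrier)

lemma mulVec_ae (β : Space d) (q : L2 Ω.toOpens ℝ) :
    ∀ᵐ x ∂(volume.restrict Ω.carrier), mulVec Ω β q x = q x • β := by
  filter_upwards [ContinuousLinearMap.coeFn_compLpL (μ := volume.restrict Ω.carrier) (p := 2)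
    (ContinuousLinearMap.toSpanSingleton ℝ β) q] with x hx
  simpa [mulVec] using hx

/-- The flux `κ ∇u + q β` of `u ∈ H^1_0(Ω)` and `q ∈ L_2(Ω)`. -/
def flux (κ : Coefficient Ω) (β : Space d) (u : H10 Ω.toOpens) (q : L2 Ω.toOpens ℝ) :
    L2 Ω.toOpens (Space d) :=
  mulCoeff κ (H10.grad Ω.toOpens u) + mulVec Ω β q

/-- The operator `B : U → V^*` of the linear problem,
`⟨B(u, σ, q, r), v⟩ = b(u, σ, q, r; v) = (κ ∇u + q β, ∇v)_𝒯 - ⟨σ, v⟩_𝒮 + (r, v)`. -/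
def B (𝒯 : Triangulation Ω) (κ : Coefficient Ω) (β : Space d) :
    TrialSpace 𝒯 →ₗ[ℝ] TestDual 𝒯 where
  toFun w := pairGrad 𝒯 (flux κ β (TrialSpace.u 𝒯 w) (TrialSpace.q 𝒯 w)) -
    (TrialSpace.σ 𝒯 w : TestDual 𝒯) + pairVal 𝒯 (TrialSpace.r 𝒯 w)
  map_add' v w := by
    simp only [flux, map_add, Submodule.coe_add]
    abel
  map_smul' c w := by
    simp only [flux, map_add, map_smul, Submodule.coe_smul, RingHom.id_apply, smul_add, smul_sub]

/-- `u ∈ H^1_0(Ω)` solves `-div κ∇u = β · ∇q - r` in `H^{-1}(Ω) = H^1_0(Ω)^*`, that is,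
`(κ∇u, ∇v) = -(q β, ∇v) - (r, v)` for all `v ∈ H^1_0(Ω)`; recall that `β` is constant, so that
`β · ∇q = div (q β)` is the functional `v ↦ -(q β, ∇v)`. -/
def SolvesPrimal (κ : Coefficient Ω) (β : Space d) (q r : L2 Ω.toOpens ℝ)
    (u : H10 Ω.toOpens) : Prop :=
  ∀ v : H10 Ω.toOpens,
    inner ℝ (mulCoeff κ (H10.grad Ω.toOpens u)) (H10.grad Ω.toOpens v) =
      - inner ℝ (mulVec Ω β q) (H10.grad Ω.toOpens v) - inner ℝ r (H10.val Ω.toOpens v)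

/-- `w = ℰ(q, r)`, that is, `w = (u, σ, q, r)` where `u ∈ H^1_0(Ω)` solves
`-div κ∇u = β · ∇q - r`, the flux `κ∇u + q β` belongs to `H(div, Ω)`, and
`σ = trn (κ∇u + q β)`. -/
def IsE (𝒯 : Triangulation Ω) (κ : Coefficient Ω) (β : Space d) (q r : L2 Ω.toOpens ℝ)
    (w : TrialSpace 𝒯) : Prop :=
  SolvesPrimal κ β q r (TrialSpace.u 𝒯 w) ∧
  (∃ τ : HDiv Ω.toOpens, HDiv.val Ω.toOpens τ = flux κ β (TrialSpace.u 𝒯 w) q ∧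
    trn 𝒯 τ = TrialSpace.σ 𝒯 w) ∧
  TrialSpace.q 𝒯 w = q ∧ TrialSpace.r 𝒯 w = r

end Operators

end DPG

end

noncomputable section

namespace DPG


/-! ### Test functions, weak derivatives, and H^1_0 with the Poincaré–Friedrichs inequality. -/

section Sobolev

variable {d : ℕ} {ω : Opens (Space d)}

/-! The primal equation says exactly that the flux κ∇u + qβ has weak divergence r
(`solvesPrimal_iff`). If it holds and σ is the trace of this flux, then ⟨σ, v⟩ = (r, v) + (κ∇u + qβ,
∇v)_𝒯, which is the cancellation B(u, σ, q, r) = 0. Conversely, functions of H^1_0(Ω) embed in the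
broken space and normal traces vanish on them (`trn_toBroken_H10`). Testing B(u, σ, q, r) = 0 with
them therefore eliminates σ and leaves the primal equation, after which B = 0 forces σ to be the
trace of the flux. Hence the kernel of B is the graph of ℰ (`isE_iff`).

That ℰ is defined and bounded follows from Lax–Milgram, with coercivity from Poincaré–Friedrichs
(`exists_weak_solution`, `exists_norm_grad_le`), and from bounding the trace norm by the H(div) norm
of the flux itself.

For the isomorphism, every functional on V is (a, ·) + (g, ∇·)_𝒯 with a, g controlled by its norm
(`exists_repr`). Take q = 0 and r = a, choose u with κ∇u - g divergence free, and let σ be the trace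
of κ∇u - g. Then B returns the functional (`exists_B_eq`). This right inverse is bounded, so the
inverse on the quotient is bounded by an explicit estimate, without the open mapping theorem. -/

/-- A test function as an element of `L_2(ω)`. -/
def testVal (φ : 𝓓(ω, ℝ)) : L2 ω ℝ := (memLp_test φ).toLp _

/-- The gradient of a test function as an element of `L_2(ω; ℝ^d)`. -/
def testGrad (φ : 𝓓(ω, ℝ)) : L2 ω (Space d) := (memLp_gradient_test φ).toLp _

lemma testVal_ae (φ : 𝓓(ω, ℝ)) :
    ∀ᵐ x ∂(volume.restrict (ω : Set (Space d))), testVal φ x = φ x :=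
  (memLp_test φ).coeFn_toLp

lemma testGrad_ae (φ : 𝓓(ω, ℝ)) :
    ∀ᵐ x ∂(volume.restrict (ω : Set (Space d))), testGrad φ x = gradient (fun x => φ x) x :=
  (memLp_gradient_test φ).coeFn_toLp

lemma inner_testVal (f : L2 ω ℝ) (φ : 𝓓(ω, ℝ)) :
    inner ℝ f (testVal φ) = ∫ x in (ω : Set (Space d)), f x * φ x := by
  rw [L2.inner_def]
  refine integral_congr_ae ?_
  filter_upwards [testVal_ae φ] with x hx
  simp [hx, mul_comm]

lemma inner_testGrad (τ : L2 ω (Space d)) (φ : 𝓓(ω, ℝ)) :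
    inner ℝ τ (testGrad φ) =
      ∫ x in (ω : Set (Space d)), inner ℝ (τ x) (gradient (fun x => φ x) x) := by
  rw [L2.inner_def]
  refine integral_congr_ae ?_
  filter_upwards [testGrad_ae φ] with x hx
  simp only [hx]

lemma isWeakDivergence_iff {τ : L2 ω (Space d)} {δ : L2 ω ℝ} :
    IsWeakDivergence ω τ δ ↔
      ∀ φ : 𝓓(ω, ℝ), inner ℝ τ (testGrad φ) = - inner ℝ δ (testVal φ) :=
  forall_congr' fun φ => by rw [inner_testGrad, inner_testVal]

lemma memLp_test_smul (φ : 𝓓(ω, ℝ)) (e : Space d) :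
    MemLp (fun x => φ x • e) 2 (volume.restrict (ω : Set (Space d))) := by
  refine (Continuous.memLp_of_hasCompactSupport ?_ ?_).restrict _
  · exact φ.continuous.smul continuous_const
  · exact φ.hasCompactSupport.comp_left (g := fun t : ℝ => t • e) (zero_smul _ _)

/-- For fixed φ and e, the defining identity compares two continuous linear functionals of the pair
(v, g). This is what makes H^1 closed in the Hilbert sum. -/
lemma isWeakGradient_iff {v : L2 ω ℝ} {g : L2 ω (Space d)} :
    IsWeakGradient ω v g ↔ ∀ (φ : 𝓓(ω, ℝ)) (e : Space d),
      inner ℝ v ((memLp_fderiv_test φ e).toLp _) = - inner ℝ g ((memLp_test_smul φ e).toLp _) := by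
  refine forall_congr' fun φ => forall_congr' fun e => ?_
  have h1 : inner ℝ v ((memLp_fderiv_test φ e).toLp _) =
      ∫ x in (ω : Set (Space d)), v x * fderiv ℝ φ x e := by
    rw [L2.inner_def]
    refine integral_congr_ae ?_
    filter_upwards [(memLp_fderiv_test φ e).coeFn_toLp] with x hx
    simp [hx, mul_comm]
  have h2 : inner ℝ g ((memLp_test_smul φ e).toLp _) =
      ∫ x in (ω : Set (Space d)), φ x * inner ℝ (g x) e := by
    rw [L2.inner_def]
    refine integral_congr_ae ?_
    filter_upwards [(memLp_test_smul φ e).coeFn_toLp] with x hx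
    simp only [hx, inner_smul_right]
  rw [h1, h2]

lemma H1.isClosed (ω : Opens (Space d)) :
    IsClosed (H1 ω : Set (WithLp 2 (L2 ω ℝ × L2 ω (Space d)))) := by
  have : (H1 ω : Set (WithLp 2 (L2 ω ℝ × L2 ω (Space d)))) =
      ⋂ (φ : 𝓓(ω, ℝ)) (e : Space d), {w | inner ℝ w.fst ((memLp_fderiv_test φ e).toLp _) =
        - inner ℝ w.snd ((memLp_test_smul φ e).toLp _)} := by
    ext w
    simp only [Set.mem_iInter]
    exact isWeakGradient_iff
  rw [this]
  refine isClosed_iInter fun φ => isClosed_iInter fun e => isClosed_eq ?_ ?_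
  · exact ((WithLp.fstL 2 ℝ _ _).continuous).inner continuous_const
  · exact (((WithLp.sndL 2 ℝ _ _).continuous).inner continuous_const).neg

instance (ω : Opens (Space d)) : CompleteSpace (H1 ω) :=
  (H1.isClosed ω).completeSpace_coe

instance (ω : Opens (Space d)) : CompleteSpace (H10 ω) :=
  (Submodule.isClosed_topologicalClosure _).completeSpace_coe

/-- The fundamental lemma of the calculus of variations. -/
lemma ae_eq_zero_of_integral_test {f : Space d → ℝ}
    (hf : MemLp f 2 (volume.restrict (ω : Set (Space d))))
    (h : ∀ φ : 𝓓(ω, ℝ), ∫ x in (ω : Set (Space d)), φ x * f x = 0) :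
    ∀ᵐ x ∂(volume.restrict (ω : Set (Space d))), f x = 0 := by
  rw [ae_restrict_iff' ω.isOpen.measurableSet]
  refine ω.isOpen.ae_eq_zero_of_integral_contDiff_smul_eq_zero ?_ ?_
  · exact fun x hx => (locallyIntegrableOn_of_locallyIntegrable_restrict
      (hf.locallyIntegrable (by norm_num))) x hx
  · intro g hg hg' hgω
    rw [← h ⟨g, hg, hg', hgω⟩, ← setIntegral_eq_integral_of_forall_compl_eq_zero (s := (ω : Set _))]
    · rfl
    · intro x hx
      rw [image_eq_zero_of_notMem_tsupport fun h' => hx (hgω h'), zero_smul]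

lemma eq_of_inner_testVal {f g : L2 ω ℝ}
    (h : ∀ φ : 𝓓(ω, ℝ), inner ℝ f (testVal φ) = inner ℝ g (testVal φ)) : f = g := by
  rw [← sub_eq_zero, Lp.eq_zero_iff_ae_eq_zero]
  refine ae_eq_zero_of_integral_test (Lp.memLp _) fun φ => ?_
  have := inner_testVal (f - g) φ
  rw [inner_sub_left, h φ, sub_self] at this
  simp_rw [mul_comm (φ _)]
  exact this.symm

lemma IsWeakDivergence.unique {τ : L2 ω (Space d)} {δ δ' : L2 ω ℝ}
    (h : IsWeakDivergence ω τ δ) (h' : IsWeakDivergence ω τ δ') : δ = δ' :=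
  eq_of_inner_testVal fun φ => by
    rw [isWeakDivergence_iff] at h h'
    exact neg_injective ((h φ).symm.trans (h' φ))

/-- Each coordinate of the difference is orthogonal to all test functions, so the fundamental lemma
applies coordinatewise. -/
lemma IsWeakGradient.unique {v : L2 ω ℝ} {g g' : L2 ω (Space d)}
    (h : IsWeakGradient ω v g) (h' : IsWeakGradient ω v g') : g = g' := by
  rw [← sub_eq_zero, Lp.eq_zero_iff_ae_eq_zero]
  have key : ∀ i : Fin d, ∀ᵐ x ∂(volume.restrict (ω : Set (Space d))),
      inner ℝ ((g - g') x) (EuclideanSpace.single i (1 : ℝ)) = 0 := by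
    intro i
    refine ae_eq_zero_of_integral_test
      ((Lp.memLp (g - g')).inner_const (𝕜 := ℝ) (EuclideanSpace.single i (1 : ℝ))) fun φ => ?_
    have i2 : ∀ g : L2 ω (Space d),
        Integrable (fun x => φ x * inner ℝ (g x) (EuclideanSpace.single i (1 : ℝ)))
        (volume.restrict (ω : Set (Space d))) :=
      fun g => (memLp_test φ).integrable_mul ((Lp.memLp g).inner_const (𝕜 := ℝ) _)
    have h1 := h φ (EuclideanSpace.single i (1 : ℝ))
    have h2 := h' φ (EuclideanSpace.single i (1 : ℝ))
    have h3 := neg_injective (h1.symm.trans h2)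
    rw [← sub_eq_zero, ← integral_sub (i2 g) (i2 g')] at h3
    rw [← h3]
    refine integral_congr_ae ?_
    filter_upwards [Lp.coeFn_sub g g'] with x hx
    rw [hx, Pi.sub_apply, inner_sub_left, mul_sub]
  filter_upwards [ae_all_iff.2 key] with x hx
  ext i
  simpa [EuclideanSpace.inner_single_right] using hx i

lemma inner_gradient_eq_fderiv (f : Space d → ℝ) (x e : Space d) :
    inner ℝ (gradient f x) e = fderiv ℝ f x e := by
  rw [gradient, InnerProductSpace.toDual_symm_apply]

/-- Integration by parts on all of ℝ^d: compact support removes boundary terms, and both integrands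
vanish outside ω. -/
lemma isWeakGradient_test (φ : 𝓓(ω, ℝ)) : IsWeakGradient ω (testVal φ) (testGrad φ) := by
  intro ψ e
  have hφ : Continuous fun x => φ x := φ.continuous
  have hψ : Continuous fun x => ψ x := ψ.continuous
  have hdφ : Continuous fun x => fderiv ℝ φ x e :=
    (continuous_fderiv_test φ).clm_apply continuous_const
  have hdψ : Continuous fun x => fderiv ℝ ψ x e :=
    (continuous_fderiv_test ψ).clm_apply continuous_const
  have hc : HasCompactSupport fun x => φ x := φ.hasCompactSupport
  have hcψ : HasCompactSupport fun x => ψ x := ψ.hasCompactSupport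
  have key : ∫ x, φ x * fderiv ℝ ψ x e = - ∫ x, fderiv ℝ φ x e * ψ x :=
    integral_mul_fderiv_eq_neg_fderiv_mul_of_integrable
      ((hdφ.mul hψ).integrable_of_hasCompactSupport hcψ.mul_left)
      ((hφ.mul hdψ).integrable_of_hasCompactSupport hc.mul_right)
      ((hφ.mul hψ).integrable_of_hasCompactSupport hc.mul_right)
      (fun x _ => φ.contDiff.differentiable (by simp) x)
      (fun x _ => ψ.contDiff.differentiable (by simp) x)
  have e1 : ∫ x in (ω : Set (Space d)), testVal φ x * fderiv ℝ ψ x e =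
      ∫ x, φ x * fderiv ℝ ψ x e := by
    refine Eq.trans (integral_congr_ae ?_)
      (setIntegral_eq_integral_of_forall_compl_eq_zero (f := fun x => φ x * fderiv ℝ ψ x e) ?_)
    · filter_upwards [testVal_ae φ] with x hx
      rw [hx]
    · intro x hx
      rw [image_eq_zero_of_notMem_tsupport fun h' => hx (φ.tsupport_subset h'), zero_mul]
  have e2 : ∫ x in (ω : Set (Space d)), ψ x * inner ℝ (testGrad φ x) e =
      ∫ x, fderiv ℝ φ x e * ψ x := by
    refine Eq.trans (integral_congr_ae ?_)
      (setIntegral_eq_integral_of_forall_compl_eq_zero (f := fun x => fderiv ℝ φ x e * ψ x) ?_)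
    · filter_upwards [testGrad_ae φ] with x hx
      rw [hx, inner_gradient_eq_fderiv, mul_comm]
    · intro x hx
      rw [image_eq_zero_of_notMem_tsupport fun h' => hx (ψ.tsupport_subset h'), mul_zero]
  rw [e1, e2, key]

/-- A test function on the smaller set is also one on the larger set, and its integrals see only the
smaller set. -/
lemma IsWeakGradient.of_le {ω' : Opens (Space d)} (h : ω ≤ ω') {v : L2 ω' ℝ} {g : L2 ω' (Space d)}
    (hv : IsWeakGradient ω' v g) : IsWeakGradient ω (restrictL2 ℝ h v) (restrictL2 _ h g) := by
  intro φ e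
  have key := hv ⟨φ, φ.contDiff, φ.hasCompactSupport, φ.tsupport_subset.trans h⟩ e
  simp only [TestFunction.coe_mk] at key
  have hv' := ((Lp.memLp v).mono_measure (Measure.restrict_mono h le_rfl)).coeFn_toLp
  have hg' := ((Lp.memLp g).mono_measure (Measure.restrict_mono h le_rfl)).coeFn_toLp
  have hφ : ∀ x ∉ (ω : Set (Space d)), x ∉ tsupport φ := fun x hx hx' => hx (φ.tsupport_subset hx')
  have e1 : ∫ x in (ω : Set (Space d)), restrictL2 ℝ h v x * fderiv ℝ φ x e =
      ∫ x in (ω' : Set (Space d)), v x * fderiv ℝ φ x e := by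
    rw [setIntegral_eq_of_subset_of_forall_sdiff_eq_zero ω'.isOpen.measurableSet h]
    · refine integral_congr_ae ?_
      filter_upwards [hv'] with x hx
      rw [← hx]
      rfl
    · rintro x ⟨-, hx⟩
      rw [image_eq_zero_of_notMem_tsupport fun h' => hφ x hx (tsupport_fderiv_subset ℝ h')]
      simp
  have e2 : ∫ x in (ω : Set (Space d)), φ x * inner ℝ (restrictL2 _ h g x) e =
      ∫ x in (ω' : Set (Space d)), φ x * inner ℝ (g x) e := by
    rw [setIntegral_eq_of_subset_of_forall_sdiff_eq_zero ω'.isOpen.measurableSet h]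
    · refine integral_congr_ae ?_
      filter_upwards [hg'] with x hx
      rw [← hx]
      rfl
    · rintro x ⟨-, hx⟩
      rw [image_eq_zero_of_notMem_tsupport (hφ x hx), zero_mul]
  rw [e1, e2]
  exact key

/-- Restriction `H^1(ω') → H^1(ω)` for `ω ⊆ ω'`. -/
def H1.restrict {ω' : Opens (Space d)} (h : ω ≤ ω') (v : H1 ω') : H1 ω :=
  ⟨WithLp.toLp 2 (restrictL2 ℝ h (H1.val ω' v), restrictL2 _ h (H1.grad ω' v)),
    IsWeakGradient.of_le h v.2⟩

/-- A test function as an element of `H^1_0(ω)`. -/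
def H10.ofTest (φ : 𝓓(ω, ℝ)) : H10 ω :=
  ⟨⟨WithLp.toLp 2 (testVal φ, testGrad φ), isWeakGradient_test φ⟩,
    Submodule.le_topologicalClosure _ ⟨φ, testVal_ae φ⟩⟩

lemma H10.continuous_val : Continuous (H10.val ω) :=
  (H1.val ω).continuous.comp continuous_subtype_val

lemma H10.continuous_grad : Continuous (H10.grad ω) :=
  (H1.grad ω).continuous.comp continuous_subtype_val

/-- A closed property that holds for test functions holds on `H^1_0(ω)`. -/
lemma H10.induction {p : L2 ω ℝ → L2 ω (Space d) → Prop}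
    (hp : IsClosed {w : L2 ω ℝ × L2 ω (Space d) | p w.1 w.2})
    (h : ∀ φ : 𝓓(ω, ℝ), p (testVal φ) (testGrad φ)) (v : H10 ω) :
    p (H10.val ω v) (H10.grad ω v) := by
  have hc : IsClosed {w : H1 ω | p (H1.val ω w) (H1.grad ω w)} :=
    hp.preimage ((H1.val ω).continuous.prodMk (H1.grad ω).continuous)
  refine closure_minimal (s := (testSubmodule ω : Set (H1 ω))) ?_ hc v.2
  rintro w ⟨φ, hφ⟩
  have h1 : H1.val ω w = testVal φ := by
    apply Lp.ext
    filter_upwards [hφ, testVal_ae φ] with x h1 h2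
    rw [h1, h2]
  -- Membership in `testSubmodule` constrains only the function, so the gradient has to be
  -- identified by uniqueness.
  have h2 : H1.grad ω w = testGrad φ :=
    IsWeakGradient.unique (v := testVal φ) (h1 ▸ w.2) (isWeakGradient_test φ)
  change p _ _
  rw [h1, h2]
  exact h φ

/-- `(τ, ∇v) = -(div τ, v)` for `τ ∈ H(div, ω)` and `v ∈ H^1_0(ω)`. -/
lemma isWeakDivergence_iff_H10 {τ : L2 ω (Space d)} {δ : L2 ω ℝ} :
    IsWeakDivergence ω τ δ ↔
      ∀ v : H10 ω, inner ℝ τ (H10.grad ω v) = - inner ℝ δ (H10.val ω v) := by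
  rw [isWeakDivergence_iff]
  refine ⟨fun h v => ?_, fun h φ => h (H10.ofTest φ)⟩
  refine H10.induction (p := fun f g => inner ℝ τ g = - inner ℝ δ f) ?_ h v
  exact isClosed_eq (by fun_prop) (by fun_prop)

lemma H1.norm_sq (v : H1 ω) : ‖v‖ ^ 2 = ‖H1.val ω v‖ ^ 2 + ‖H1.grad ω v‖ ^ 2 :=
  WithLp.prod_norm_sq_eq_of_L2 (v : WithLp 2 (L2 ω ℝ × L2 ω (Space d)))

lemma HDiv.norm_sq (τ : HDiv ω) : ‖τ‖ ^ 2 = ‖HDiv.val ω τ‖ ^ 2 + ‖HDiv.div ω τ‖ ^ 2 :=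
  WithLp.prod_norm_sq_eq_of_L2 (τ : WithLp 2 (L2 ω (Space d) × L2 ω ℝ))

lemma H10.norm_sq (v : H10 ω) : ‖v‖ ^ 2 = ‖H10.val ω v‖ ^ 2 + ‖H10.grad ω v‖ ^ 2 :=
  H1.norm_sq v.1

/-- The Poincaré–Friedrichs inequality. -/
lemma H10.exists_norm_val_le (hd : 2 ≤ d) (hω : Bornology.IsBounded (ω : Set (Space d))) :
    ∃ C : ℝ, 0 ≤ C ∧ ∀ v : H10 ω, ‖H10.val ω v‖ ≤ C * ‖H10.grad ω v‖ := by
  have hd' : (2 : ℝ) ≤ d := by exact_mod_cast hd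
  -- The exponent whose Sobolev conjugate is 2: 1/p - 1/d = 1/2. The condition 1 ≤ p is exactly 2 ≤
  -- d.
  set p : ℝ≥0 := 2 * d / (d + 2) with hp
  have hp' : (p : ℝ) = 2 * d / (d + 2) := by rw [hp]; push_cast; rfl
  have hp1 : 1 ≤ p := by
    rw [← NNReal.coe_le_coe, hp', NNReal.coe_one, le_div_iff₀ (by positivity)]
    linarith
  have hp2 : p ≤ 2 := by
    rw [← NNReal.coe_le_coe, hp', NNReal.coe_ofNat, div_le_iff₀ (by positivity)]
    linarith
  have hpd : p < d := by
    rw [← NNReal.coe_lt_coe, hp', NNReal.coe_natCast, div_lt_iff₀ (by positivity)]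
    nlinarith
  set K : ℝ≥0 := eLpNormLESNormFDerivOfLeConst ℝ (volume : Measure (Space d)) (ω : Set (Space d)) p 2
  -- The Hölder constant for passing from the L_p norm of the gradient to its L_2 norm; it is finite
  -- because ω is bounded and p ≤ 2.
  set M : ℝ≥0∞ := (volume (ω : Set (Space d))) ^ (1 / (p : ℝ≥0∞).toReal - 1 / (2 : ℝ≥0∞).toReal)
    with hMdef
  have hM : M ≠ ∞ := by
    refine ENNReal.rpow_ne_top_of_nonneg ?_ hω.measure_lt_top.ne
    have h0 : (0 : ℝ) < p := lt_of_lt_of_le one_pos (by exact_mod_cast hp1)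
    rw [sub_nonneg]
    exact one_div_le_one_div_of_le (by simpa using h0) (by simpa using NNReal.coe_le_coe.2 hp2)
  refine ⟨K * M.toReal, by positivity, fun v => ?_⟩
  refine H10.induction (p := fun f g => ‖f‖ ≤ K * M.toReal * ‖g‖) ?_ (fun φ => ?_) v
  · exact isClosed_le (by fun_prop) (by fun_prop)
  have h1 : eLpNorm (fun x => φ x) (2 : ℝ≥0) volume ≤
      K * eLpNorm (fderiv ℝ (fun x => φ x)) p volume := by
    refine eLpNorm_le_eLpNorm_fderiv_of_le (F := ℝ) (μ := (volume : Measure (Space d)))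
      (φ.contDiff.of_le (by simp)) (s := (ω : Set (Space d)))
      ((subset_tsupport _).trans φ.tsupport_subset) hp1 ?_ ?_ hω
    · rwa [finrank_euclideanSpace_fin]
    · rw [finrank_euclideanSpace_fin, NNReal.coe_inv, hp']
      apply le_of_eq
      push_cast
      field_simp
      ring
  have h2 : eLpNorm (fderiv ℝ (fun x => φ x)) p volume =
      eLpNorm (gradient (fun x => φ x)) p (volume.restrict (ω : Set (Space d))) := by
    rw [eLpNorm_restrict_eq_of_support_subset]
    · exact eLpNorm_congr_norm_ae (.of_forall fun x => by simp [gradient])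
    · refine subset_trans ?_ ((tsupport_fderiv_subset ℝ).trans φ.tsupport_subset)
      refine subset_trans (fun x hx => ?_) (subset_tsupport _)
      simpa [gradient] using hx
  have h3 : eLpNorm (gradient (fun x => φ x)) p (volume.restrict (ω : Set (Space d))) ≤
      eLpNorm (gradient (fun x => φ x)) 2 (volume.restrict (ω : Set (Space d))) * M := by
    have := eLpNorm_le_eLpNorm_mul_rpow_measure_univ (p := p) (q := 2)
      (μ := volume.restrict (ω : Set (Space d))) (f := gradient (fun x => φ x))
      (by exact_mod_cast hp2) (memLp_gradient_test φ).1
    rwa [Measure.restrict_apply_univ] at this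
  have h4 : eLpNorm (fun x => φ x) 2 (volume.restrict (ω : Set (Space d))) ≤
      K * (eLpNorm (gradient (fun x => φ x)) 2 (volume.restrict (ω : Set (Space d))) * M) := by
    refine (eLpNorm_mono_measure _ Measure.restrict_le_self).trans (h1.trans ?_)
    rw [h2]
    gcongr
  have h5 := ENNReal.toReal_mono ?_ h4
  · rw [ENNReal.toReal_mul, ENNReal.toReal_mul, ENNReal.coe_toReal] at h5
    rw [testVal, testGrad, Lp.norm_toLp, Lp.norm_toLp]
    linarith
  · exact ENNReal.mul_ne_top ENNReal.coe_ne_top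
      (ENNReal.mul_ne_top (memLp_gradient_test φ).eLpNorm_ne_top hM)

end Sobolev


/-! ### Coercivity, existence and energy estimate for the primal problem. -/

section Primal

variable {d : ℕ} {Ω : LipschitzDomain d}

local instance (ω : Opens (Space d)) : NormedAddCommGroup (H10 ω) :=
  Submodule.normedAddCommGroup _

local instance (ω : Opens (Space d)) : InnerProductSpace ℝ (H10 ω) :=
  Submodule.innerProductSpace _

local instance (ω : Opens (Space d)) : NormedSpace ℝ (H10 ω) :=
  InnerProductSpace.toNormedSpace

lemma Coefficient.IsUniformlyPosDef.exists_le_inner {κ : Coefficient Ω}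
    (hκ : κ.IsUniformlyPosDef) : ∃ α : ℝ, 0 < α ∧ ∀ τ : L2 Ω.toOpens (Space d),
      α * ‖τ‖ ^ 2 ≤ inner ℝ (mulCoeff κ τ) τ := by
  obtain ⟨α, hα, h⟩ := hκ
  refine ⟨α, hα, fun τ => ?_⟩
  rw [← real_inner_self_eq_norm_sq, L2.inner_def, L2.inner_def, ← integral_const_mul]
  refine integral_mono_ae ((L2.integrable_inner (𝕜 := ℝ) τ τ).const_mul α)
    (L2.integrable_inner (𝕜 := ℝ) (mulCoeff κ τ) τ) ?_
  filter_upwards [h, mulCoeff_ae κ τ] with x hx hx'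
  rw [hx', real_inner_self_eq_norm_sq]
  exact hx _

/-- The gradient of an element of `H^1_0(ω)`, as a continuous linear map. -/
def H10.gradL (ω : Opens (Space d)) : H10 ω →L[ℝ] L2 ω (Space d) :=
  ⟨H10.grad ω, H10.continuous_grad⟩

/-- The function of an element of `H^1_0(ω)`, as a continuous linear map. -/
def H10.valL (ω : Opens (Space d)) : H10 ω →L[ℝ] L2 ω ℝ :=
  ⟨H10.val ω, H10.continuous_val⟩

/-- A form of the Lax–Milgram lemma. -/
lemma exists_forall_inner_eq {H X : Type*} [NormedAddCommGroup H] [InnerProductSpace ℝ H]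
    [CompleteSpace H] [NormedAddCommGroup X] [InnerProductSpace ℝ X] (G : H →L[ℝ] X)
    (K : X →L[ℝ] X) {c : ℝ} (hc : 0 < c) (h : ∀ u, c * ‖u‖ ^ 2 ≤ inner ℝ (K (G u)) (G u))
    (l : H →L[ℝ] ℝ) : ∃ u, ∀ v, inner ℝ (K (G u)) (G v) = l v := by
  set A : H →L[ℝ] H →L[ℝ] ℝ := (innerSL ℝ).bilinearComp (K.comp G) G with hA
  have hA' : ∀ u v, A u v = inner ℝ (K (G u)) (G v) := fun u v => rfl
  have hco : IsCoercive A := ⟨c, hc, fun u => by rw [mul_assoc, ← sq]; exact h u⟩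
  refine ⟨hco.continuousLinearEquivOfBilin.symm ((InnerProductSpace.toDual ℝ _).symm l),
    fun v => ?_⟩
  rw [← hA', ← hco.continuousLinearEquivOfBilin_apply,
    ContinuousLinearEquiv.apply_symm_apply, InnerProductSpace.toDual_symm_apply]

/-- Positive definiteness controls only the gradient; Poincaré–Friedrichs converts this into control
of the full H^1 norm, as Lax–Milgram requires. -/
lemma exists_energy_coercive (hd : 2 ≤ d) {κ : Coefficient Ω} (hκ : κ.IsUniformlyPosDef) :
    ∃ c : ℝ, 0 < c ∧ ∀ u : H10 Ω.toOpens, c * ‖u‖ ^ 2 ≤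
      inner ℝ (mulCoeff κ (H10.grad Ω.toOpens u)) (H10.grad Ω.toOpens u) := by
  obtain ⟨α, hα, h⟩ := hκ.exists_le_inner
  obtain ⟨C, hC, hP⟩ := H10.exists_norm_val_le (ω := Ω.toOpens) hd Ω.isBounded
  refine ⟨α / (C ^ 2 + 1), by positivity, fun u => ?_⟩
  have h1 : ‖u‖ ^ 2 ≤ (C ^ 2 + 1) * ‖H10.grad Ω.toOpens u‖ ^ 2 := by
    have h2 := pow_le_pow_left₀ (norm_nonneg _) (hP u) 2
    rw [H10.norm_sq, add_mul, one_mul, ← mul_pow]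
    gcongr
  refine le_trans ?_ (h (H10.grad Ω.toOpens u))
  rw [div_mul_eq_mul_div, div_le_iff₀ (by positivity)]
  nlinarith

/-- `-div κ∇u = -div g + f` has a solution `u ∈ H^1_0(Ω)`. -/
lemma exists_weak_solution (hd : 2 ≤ d) {κ : Coefficient Ω} (hκ : κ.IsUniformlyPosDef)
    (g : L2 Ω.toOpens (Space d)) (f : L2 Ω.toOpens ℝ) :
    ∃ u : H10 Ω.toOpens, ∀ v : H10 Ω.toOpens,
      inner ℝ (mulCoeff κ (H10.grad Ω.toOpens u)) (H10.grad Ω.toOpens v) =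
        inner ℝ g (H10.grad Ω.toOpens v) + inner ℝ f (H10.val Ω.toOpens v) := by
  obtain ⟨c, hc, h⟩ := exists_energy_coercive hd hκ
  exact exists_forall_inner_eq (H10.gradL Ω.toOpens) (mulCoeff κ) hc h
    ((innerSL ℝ g).comp (H10.gradL Ω.toOpens) + (innerSL ℝ f).comp (H10.valL Ω.toOpens))

/-- The energy estimate for weak solutions. -/
lemma exists_norm_grad_le (hd : 2 ≤ d) {κ : Coefficient Ω} (hκ : κ.IsUniformlyPosDef) :
    ∃ C : ℝ, 0 ≤ C ∧ ∀ (g : L2 Ω.toOpens (Space d)) (f : L2 Ω.toOpens ℝ) (u : H10 Ω.toOpens),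
      (∀ v : H10 Ω.toOpens,
        inner ℝ (mulCoeff κ (H10.grad Ω.toOpens u)) (H10.grad Ω.toOpens v) =
          inner ℝ g (H10.grad Ω.toOpens v) + inner ℝ f (H10.val Ω.toOpens v)) →
      ‖H10.grad Ω.toOpens u‖ ≤ C * (‖g‖ + ‖f‖) := by
  obtain ⟨α, hα, h⟩ := hκ.exists_le_inner
  obtain ⟨C, hC, hP⟩ := H10.exists_norm_val_le (ω := Ω.toOpens) hd Ω.isBounded
  refine ⟨(C + 1) / α, by positivity, fun g f u hu => ?_⟩
  have h1 := h (H10.grad Ω.toOpens u)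
  -- Testing with u itself gives α G² ≤ (‖g‖ + C ‖f‖) G for G = ‖∇u‖; one factor G is then
  -- cancelled, the case G = 0 being treated apart.
  rw [hu u] at h1
  have h2 := real_inner_le_norm g (H10.grad Ω.toOpens u)
  have h3 := real_inner_le_norm f (H10.val Ω.toOpens u)
  have h4 := mul_le_mul_of_nonneg_left (hP u) (norm_nonneg f)
  set G := ‖H10.grad Ω.toOpens u‖
  have hG : 0 ≤ G := norm_nonneg _
  rw [div_mul_eq_mul_div, le_div_iff₀ hα]
  rcases hG.eq_or_lt with h0 | h0
  · rw [← h0, zero_mul]; positivity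
  · refine le_of_mul_le_mul_right ?_ h0
    have := mul_nonneg (mul_nonneg hC (norm_nonneg g)) hG
    have := mul_nonneg (norm_nonneg f) hG
    nlinarith

lemma H10.eq_zero_of_grad_eq_zero (hd : 2 ≤ d) {u : H10 Ω.toOpens}
    (h : H10.grad Ω.toOpens u = 0) : u = 0 := by
  obtain ⟨C, hC, hP⟩ := H10.exists_norm_val_le (ω := Ω.toOpens) hd Ω.isBounded
  have h1 := hP u
  rw [h, norm_zero, mul_zero] at h1
  have h2 : ‖H10.val Ω.toOpens u‖ = 0 := le_antisymm h1 (norm_nonneg _)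
  have h3 := H10.norm_sq u
  rw [h2, h, norm_zero] at h3
  exact norm_eq_zero.1 (pow_eq_zero_iff two_ne_zero |>.1 (by simpa using h3))

end Primal

/-! ### The mesh decomposition and the broken pairings. -/

section Mesh

variable {d : ℕ} {Ω : LipschitzDomain d}

/-- By conformity the two closed simplices meet in the hull of their common vertices. Distinct cells
share at most d vertices, which cannot affinely span ℝ^d, so that hull has empty interior. -/
lemma Triangulation.disjoint_element (𝒯 : Triangulation Ω) {S T : 𝒯.cells} (h : S ≠ T) :
    Disjoint (element S.1 : Set (Space d)) (element T.1) := by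
  rw [Set.disjoint_iff_inter_eq_empty]
  change interior (convexHull ℝ (S.1 : Set (Space d))) ∩
    interior (convexHull ℝ (T.1 : Set (Space d))) = ∅
  rw [← interior_inter, 𝒯.inter_eq _ S.2 _ T.2, ← Set.not_nonempty_iff_eq_empty,
    interior_convexHull_nonempty_iff_affineSpan_eq_top]
  intro htop
  classical
  have hlt : (S.1 ∩ T.1).card < d + 1 := by
    rw [← 𝒯.card_eq _ S.2]
    refine Finset.card_lt_card (Finset.inter_subset_left.ssubset_of_ne fun heq => h ?_)
    refine Subtype.ext (Finset.eq_of_subset_of_card_le (Finset.inter_eq_left.1 heq) ?_)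
    rw [𝒯.card_eq _ S.2, 𝒯.card_eq _ T.2]
  rw [← Finset.coe_inter] at htop
  have hne : (S.1 ∩ T.1).Nonempty := by
    by_contra hne
    rw [Finset.not_nonempty_iff_eq_empty] at hne
    rw [hne, Finset.coe_empty, AffineSubspace.span_empty] at htop
    exact AffineSubspace.bot_ne_top ℝ (Space d) (Space d) htop
  -- The subtraction is truncated, so `card - 1` is the right dimension bound only for a nonempty
  -- set; hence the separate treatment of the empty intersection above.
  have h1 := finrank_vectorSpan_image_finset_le ℝ (fun x : Space d => x) (S.1 ∩ T.1)
    (n := (S.1 ∩ T.1).card - 1) (by have := hne.card_pos; omega)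
  rw [Finset.image_id', ← direction_affineSpan, htop, AffineSubspace.direction_top, finrank_top,
    finrank_euclideanSpace_fin] at h1
  have := hne.card_pos
  omega

/-- The closed cells cover Ω, and the frontier of a convex set is Lebesgue null, so only a null set
escapes the finitely many interiors. -/
lemma Triangulation.ae_mem_iUnion (𝒯 : Triangulation Ω) :
    ∀ᵐ x ∂(volume.restrict Ω.carrier), x ∈ ⋃ T : 𝒯.cells, (element T.1 : Set (Space d)) := by
  have h : ∀ T : 𝒯.cells, ∀ᵐ x ∂(volume : Measure (Space d)),
      x ∉ frontier (convexHull ℝ (T.1 : Set (Space d))) := fun T =>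
    measure_eq_zero_iff_ae_notMem.1 ((convex_convexHull ℝ _).addHaar_frontier volume)
  filter_upwards [ae_restrict_of_ae (ae_all_iff.2 h), ae_restrict_mem Ω.is_open'.measurableSet]
    with x hx hxΩ
  have := subset_closure hxΩ
  rw [← 𝒯.iUnion_eq] at this
  simp only [Set.mem_iUnion] at this ⊢
  obtain ⟨s, hs, hxs⟩ := this
  refine ⟨⟨s, hs⟩, ?_⟩
  by_contra hni
  exact hx ⟨s, hs⟩ ⟨subset_closure hxs, hni⟩

lemma Triangulation.sum_setIntegral (𝒯 : Triangulation Ω) {f : Space d → ℝ}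
    (hf : IntegrableOn f Ω.carrier) :
    ∑ T : 𝒯.cells, ∫ x in (element T.1 : Set (Space d)), f x = ∫ x in Ω.carrier, f x := by
  have hs := integral_iUnion_fintype (s := fun T : 𝒯.cells => (element T.1 : Set (Space d)))
    (fun T => (element T.1).isOpen.measurableSet)
    (fun S T h => 𝒯.disjoint_element h) (fun T => hf.mono_set (𝒯.element_le T))
  rw [← hs]
  refine setIntegral_congr_set (Filter.eventuallyLE_antisymm_iff.2 ⟨?_, ?_⟩)
  · exact (Set.iUnion_subset fun T => 𝒯.element_le T).eventuallyLE
  · exact (ae_restrict_iff' Ω.is_open'.measurableSet).1 𝒯.ae_mem_iUnion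

/-- The embedding `H^1(Ω) → H^1(𝒯)`. -/
def toBroken (𝒯 : Triangulation Ω) (v : H1 Ω.toOpens) : TestSpace 𝒯 :=
  WithLp.toLp 2 fun T => H1.restrict (𝒯.element_le T) v

lemma restrictL2_ae (F : Type) [NormedAddCommGroup F] [NormedSpace ℝ F] {ω ω' : Opens (Space d)}
    (h : ω ≤ ω') (f : L2 ω' F) :
    ∀ᵐ x ∂(volume.restrict (ω : Set (Space d))), restrictL2 F h f x = f x :=
  ((Lp.memLp f).mono_measure (Measure.restrict_mono h le_rfl)).coeFn_toLp

/-- On a function of H^1(Ω) the elementwise integrals add up to the global one, since the elements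
are disjoint and fill Ω up to a null set. -/
lemma pairVal_toBroken (𝒯 : Triangulation Ω) (f : L2 Ω.toOpens ℝ) (v : H1 Ω.toOpens) :
    pairVal 𝒯 f (toBroken 𝒯 v) = inner ℝ f (H1.val Ω.toOpens v) := by
  rw [pairVal_apply, L2.inner_def]
  refine Eq.trans (Finset.sum_congr rfl fun T _ => integral_congr_ae ?_)
    (𝒯.sum_setIntegral (L2.integrable_inner (𝕜 := ℝ) f (H1.val Ω.toOpens v)))
  filter_upwards [restrictL2_ae ℝ (𝒯.element_le T) (H1.val Ω.toOpens v)] with x hx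
  change f x * restrictL2 ℝ (𝒯.element_le T) (H1.val Ω.toOpens v) x = _
  rw [hx]
  simp [mul_comm]

lemma pairGrad_toBroken (𝒯 : Triangulation Ω) (τ : L2 Ω.toOpens (Space d)) (v : H1 Ω.toOpens) :
    pairGrad 𝒯 τ (toBroken 𝒯 v) = inner ℝ τ (H1.grad Ω.toOpens v) := by
  rw [pairGrad_apply, L2.inner_def]
  refine Eq.trans (Finset.sum_congr rfl fun T _ => integral_congr_ae ?_)
    (𝒯.sum_setIntegral (L2.integrable_inner (𝕜 := ℝ) τ (H1.grad Ω.toOpens v)))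
  filter_upwards [restrictL2_ae _ (𝒯.element_le T) (H1.grad Ω.toOpens v)] with x hx
  change inner ℝ (τ x) (restrictL2 _ (𝒯.element_le T) (H1.grad Ω.toOpens v) x) = _
  rw [hx]

lemma norm_restrictL2_le (F : Type) [NormedAddCommGroup F] [NormedSpace ℝ F]
    {ω ω' : Opens (Space d)} (h : ω ≤ ω') (f : L2 ω' F) : ‖restrictL2 F h f‖ ≤ ‖f‖ := by
  change ‖((Lp.memLp f).mono_measure (Measure.restrict_mono h le_rfl)).toLp _‖ ≤ _
  rw [Lp.norm_toLp, Lp.norm_def]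
  exact ENNReal.toReal_mono (Lp.eLpNorm_ne_top f)
    (eLpNorm_mono_measure _ (Measure.restrict_mono h le_rfl))

lemma pairVal_eq_sum (𝒯 : Triangulation Ω) (f : L2 Ω.toOpens ℝ) (v : TestSpace 𝒯) :
    pairVal 𝒯 f v = ∑ T : 𝒯.cells,
      inner ℝ (restrictL2 ℝ (𝒯.element_le T) f) (H1.val (element T.1) (v T)) := by
  simp only [pairVal, LinearMap.sum_apply, LinearMap.coe_mk, AddHom.coe_mk,
    _root_.sum_apply, ContinuousLinearMap.comp_apply, innerSL_apply_apply, PiLp.proj_apply]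

lemma pairGrad_eq_sum (𝒯 : Triangulation Ω) (τ : L2 Ω.toOpens (Space d)) (v : TestSpace 𝒯) :
    pairGrad 𝒯 τ v = ∑ T : 𝒯.cells,
      inner ℝ (restrictL2 _ (𝒯.element_le T) τ) (H1.grad (element T.1) (v T)) := by
  simp only [pairGrad, LinearMap.sum_apply, LinearMap.coe_mk, AddHom.coe_mk,
    _root_.sum_apply, ContinuousLinearMap.comp_apply, innerSL_apply_apply, PiLp.proj_apply]

lemma H1.norm_val_le {ω : Opens (Space d)} (v : H1 ω) : ‖H1.val ω v‖ ≤ ‖v‖ :=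
  le_of_sq_le_sq (by rw [H1.norm_sq]; simp) (norm_nonneg _)

lemma H1.norm_grad_le {ω : Opens (Space d)} (v : H1 ω) : ‖H1.grad ω v‖ ≤ ‖v‖ :=
  le_of_sq_le_sq (by rw [H1.norm_sq]; simp) (norm_nonneg _)

lemma HDiv.norm_val_le {ω : Opens (Space d)} (τ : HDiv ω) : ‖HDiv.val ω τ‖ ≤ ‖τ‖ :=
  le_of_sq_le_sq (by rw [HDiv.norm_sq]; simp) (norm_nonneg _)

lemma HDiv.norm_div_le {ω : Opens (Space d)} (τ : HDiv ω) : ‖HDiv.div ω τ‖ ≤ ‖τ‖ :=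
  le_of_sq_le_sq (by rw [HDiv.norm_sq]; simp) (norm_nonneg _)

lemma HDiv.norm_le {ω : Opens (Space d)} (τ : HDiv ω) :
    ‖τ‖ ≤ ‖HDiv.val ω τ‖ + ‖HDiv.div ω τ‖ := by
  refine le_of_sq_le_sq ?_ (by positivity)
  rw [HDiv.norm_sq]
  nlinarith [mul_nonneg (norm_nonneg (HDiv.val ω τ)) (norm_nonneg (HDiv.div ω τ))]

/-- Summing the Cauchy–Schwarz bounds costs a factor equal to the number of cells; only boundedness
is needed. -/
lemma norm_pairVal_le (𝒯 : Triangulation Ω) (f : L2 Ω.toOpens ℝ) :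
    ‖pairVal 𝒯 f‖ ≤ Fintype.card 𝒯.cells * ‖f‖ := by
  refine ContinuousLinearMap.opNorm_le_bound _ (by positivity) fun v => ?_
  rw [pairVal_eq_sum, ← nsmul_eq_mul, ← Finset.card_univ, smul_mul_assoc, ← Finset.sum_const]
  refine (norm_sum_le _ _).trans (Finset.sum_le_sum fun T _ => (norm_inner_le_norm _ _).trans ?_)
  gcongr
  · exact norm_restrictL2_le _ _ _
  · exact (H1.norm_val_le _).trans (PiLp.norm_apply_le v T)

lemma norm_pairGrad_le (𝒯 : Triangulation Ω) (τ : L2 Ω.toOpens (Space d)) :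
    ‖pairGrad 𝒯 τ‖ ≤ Fintype.card 𝒯.cells * ‖τ‖ := by
  refine ContinuousLinearMap.opNorm_le_bound _ (by positivity) fun v => ?_
  rw [pairGrad_eq_sum, ← nsmul_eq_mul, ← Finset.card_univ, smul_mul_assoc, ← Finset.sum_const]
  refine (norm_sum_le _ _).trans (Finset.sum_le_sum fun T _ => (norm_inner_le_norm _ _).trans ?_)
  gcongr
  · exact norm_restrictL2_le _ _ _
  · exact (H1.norm_grad_le _).trans (PiLp.norm_apply_le v T)

lemma norm_trn_le (𝒯 : Triangulation Ω) (τ : HDiv Ω.toOpens) :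
    ‖trn 𝒯 τ‖ ≤ 2 * Fintype.card 𝒯.cells * ‖τ‖ := by
  have h1 := norm_pairVal_le 𝒯 (HDiv.div Ω.toOpens τ)
  have h2 := norm_pairGrad_le 𝒯 (HDiv.val Ω.toOpens τ)
  have h3 : (Fintype.card 𝒯.cells : ℝ) * ‖HDiv.div Ω.toOpens τ‖ ≤ Fintype.card 𝒯.cells * ‖τ‖ := by
    gcongr; exact HDiv.norm_div_le τ
  have h4 : (Fintype.card 𝒯.cells : ℝ) * ‖HDiv.val Ω.toOpens τ‖ ≤ Fintype.card 𝒯.cells * ‖τ‖ := by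
    gcongr; exact HDiv.norm_val_le τ
  refine (norm_add_le (pairVal 𝒯 (HDiv.div Ω.toOpens τ))
    (pairGrad 𝒯 (HDiv.val Ω.toOpens τ))).trans ?_
  linarith

/-- The bound for `trn` is applied to almost minimal representatives, and ε then tends to 0, so the
infimum need not be attained. -/
lemma norm_le_traceNorm (𝒯 : Triangulation Ω) (σ : Trace 𝒯) :
    ‖(σ : TestDual 𝒯)‖ ≤ 2 * Fintype.card 𝒯.cells * traceNorm 𝒯 σ := by
  have h : ∀ ε > 0, ‖(σ : TestDual 𝒯)‖ ≤ 2 * Fintype.card 𝒯.cells * (traceNorm 𝒯 σ + ε) := by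
    intro ε hε
    obtain ⟨τ, hτ, hlt⟩ := exists_lt_of_traceNorm_lt 𝒯 σ (lt_add_of_pos_right _ hε)
    rw [← hτ]
    exact (norm_trn_le 𝒯 τ).trans (by gcongr)
  refine ge_of_tendsto (x := 𝓝[>] (0 : ℝ)) (f := fun ε =>
    2 * (Fintype.card 𝒯.cells : ℝ) * (traceNorm 𝒯 σ + ε)) ?_ ?_
  · refine Filter.Tendsto.mono_left ?_ nhdsWithin_le_nhds
    exact Continuous.tendsto' (by fun_prop) _ _ (by simp)
  · filter_upwards [self_mem_nhdsWithin] with ε hε using h ε hε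

/-! ### Extension by zero and representation of functionals on the broken space. -/

/-- Extension by zero `L_2(T; F) → L_2(Ω; F)`. -/
def extendL2 (F : Type) [NormedAddCommGroup F] [NormedSpace ℝ F] {ω : Opens (Space d)}
    (ω' : Opens (Space d)) (f : L2 ω F) : L2 ω' F :=
  (((memLp_indicator_iff_restrict ω.isOpen.measurableSet).2 (Lp.memLp f)).restrict
    (ω' : Set (Space d))).toLp _

lemma norm_extendL2_le (F : Type) [NormedAddCommGroup F] [NormedSpace ℝ F] {ω : Opens (Space d)}
    (ω' : Opens (Space d)) (f : L2 ω F) : ‖extendL2 F ω' f‖ ≤ ‖f‖ := by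
  rw [extendL2, Lp.norm_toLp, Lp.norm_def]
  refine ENNReal.toReal_mono (Lp.eLpNorm_ne_top f) ?_
  rw [← eLpNorm_indicator_eq_eLpNorm_restrict ω.isOpen.measurableSet]
  exact eLpNorm_mono_measure _ Measure.restrict_le_self

lemma extendL2_ae (F : Type) [NormedAddCommGroup F] [NormedSpace ℝ F] {ω : Opens (Space d)}
    (ω' : Opens (Space d)) (f : L2 ω F) :
    ∀ᵐ x ∂(volume.restrict (ω' : Set (Space d))),
      extendL2 F ω' f x = (ω : Set (Space d)).indicator f x :=
  MemLp.coeFn_toLp _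

lemma restrictL2_extendL2 (F : Type) [NormedAddCommGroup F] [NormedSpace ℝ F]
    {ω ω' : Opens (Space d)} (h : ω ≤ ω') (f : L2 ω F) :
    restrictL2 F h (extendL2 F ω' f) = f := by
  apply Lp.ext
  filter_upwards [restrictL2_ae F h (extendL2 F ω' f),
    ae_mono (Measure.restrict_mono h le_rfl) (extendL2_ae F ω' f),
    ae_restrict_mem ω.isOpen.measurableSet] with x h1 h2 h3
  rw [h1, h2, Set.indicator_of_mem h3]

lemma restrictL2_extendL2_of_disjoint (F : Type) [NormedAddCommGroup F] [NormedSpace ℝ F]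
    {ω₁ ω ω' : Opens (Space d)} (h : ω ≤ ω')
    (hdisj : Disjoint (ω₁ : Set (Space d)) (ω : Set (Space d))) (f : L2 ω₁ F) :
    restrictL2 F h (extendL2 F ω' f) = 0 := by
  apply Lp.ext
  filter_upwards [restrictL2_ae F h (extendL2 F ω' f),
    ae_mono (Measure.restrict_mono h le_rfl) (extendL2_ae F ω' f),
    ae_restrict_mem ω.isOpen.measurableSet, Lp.coeFn_zero F 2 (volume.restrict (ω : Set (Space d)))]
    with x h1 h2 h3 h4
  rw [h1, h2, h4, Set.indicator_of_notMem (hdisj.notMem_of_mem_right h3)]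
  rfl

/-- L_2 data can be prescribed independently on each element, with no compatibility across faces.
This glues local representers into global ones. -/
lemma Triangulation.restrictL2_sum_extendL2 (𝒯 : Triangulation Ω) (F : Type) [NormedAddCommGroup F]
    [NormedSpace ℝ F] (f : ∀ T : 𝒯.cells, L2 (element T.1) F) (T : 𝒯.cells) :
    restrictL2 F (𝒯.element_le T) (∑ S : 𝒯.cells, extendL2 F Ω.toOpens (f S)) = f T := by
  rw [map_sum, Finset.sum_eq_single T]
  · exact restrictL2_extendL2 F _ _
  · exact fun S _ h => restrictL2_extendL2_of_disjoint F _ (𝒯.disjoint_element h) _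
  · simp

/-- A functional on `H^1(ω)` has the form `v ↦ (a, v) + (g, ∇v)`. -/
lemma H1.exists_repr {ω : Opens (Space d)} (l : StrongDual ℝ (H1 ω)) :
    ∃ (a : L2 ω ℝ) (g : L2 ω (Space d)), ‖a‖ ≤ ‖l‖ ∧ ‖g‖ ≤ ‖l‖ ∧
      ∀ v, l v = inner ℝ a (H1.val ω v) + inner ℝ g (H1.grad ω v) := by
  -- Hahn–Banach extends the functional with the same norm to the whole Hilbert sum, where the two
  -- components of its Riesz representer are a and g.
  obtain ⟨L, hL, hnorm⟩ := exists_extension_norm_eq (H1 ω) l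
  set w := (InnerProductSpace.toDual ℝ _).symm L with hw
  have hwn : ‖w‖ = ‖l‖ := by rw [hw, LinearIsometryEquiv.norm_map, hnorm]
  have hsq := WithLp.prod_norm_sq_eq_of_L2 w
  refine ⟨w.fst, w.snd, ?_, ?_, fun v => ?_⟩
  · rw [← hwn]
    exact le_of_sq_le_sq (by rw [hsq]; simp) (norm_nonneg _)
  · rw [← hwn]
    exact le_of_sq_le_sq (by rw [hsq]; simp) (norm_nonneg _)
  · rw [← hL v, ← InnerProductSpace.toDual_symm_apply, ← hw, WithLp.prod_inner_apply]
    rfl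

end Mesh


/-- Precompose with the inclusions of the factors: they are isometric, so no component exceeds the
norm of l. -/
lemma exists_forall_apply_eq_sum {ι : Type*} [Fintype ι] {E : ι → Type*}
    [∀ i, NormedAddCommGroup (E i)] [∀ i, NormedSpace ℝ (E i)] (l : PiLp 2 E →L[ℝ] ℝ) :
    ∃ m : ∀ i, E i →L[ℝ] ℝ, (∀ i, ‖m i‖ ≤ ‖l‖) ∧ ∀ v, l v = ∑ i, m i (v i) := by
  classical
  have hb : ∀ i (x : E i), ‖l (PiLp.single 2 i x)‖ ≤ ‖l‖ * ‖x‖ := fun i x => by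
    rw [← PiLp.norm_single 2 E i x]
    exact l.le_opNorm _
  refine ⟨fun i => LinearMap.mkContinuous
    { toFun := fun x => l (PiLp.single 2 i x)
      map_add' := fun x y => by rw [PiLp.single_add, map_add]
      map_smul' := fun c x => by
        rw [RingHom.id_apply, ← map_smul, ← PiLp.toLp_single, Pi.single_smul]; rfl }
    ‖l‖ (hb i), fun i => LinearMap.mkContinuous_norm_le _ (norm_nonneg _) _, fun v => ?_⟩
  have hv : v = ∑ i, PiLp.single 2 i (v i) := by
    ext j
    rw [WithLp.ofLp_sum, Finset.sum_apply, Finset.sum_eq_single j]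
    · simp
    · exact fun i _ h => PiLp.single_eq_of_ne' _ h _
    · simp
  conv_lhs => rw [hv, map_sum]
  rfl

section Mesh

variable {d : ℕ} {Ω : LipschitzDomain d}

/-- A functional on `H^1(𝒯)` has the form `v ↦ (a, v) + (g, ∇v)_𝒯`. -/
lemma exists_repr (𝒯 : Triangulation Ω) (l : TestDual 𝒯) :
    ∃ (a : L2 Ω.toOpens ℝ) (g : L2 Ω.toOpens (Space d)),
      ‖a‖ ≤ Fintype.card 𝒯.cells * ‖l‖ ∧ ‖g‖ ≤ Fintype.card 𝒯.cells * ‖l‖ ∧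
      l = pairVal 𝒯 a + pairGrad 𝒯 g := by
  obtain ⟨m, hm, hml⟩ := exists_forall_apply_eq_sum l
  choose a g ha hg hag using fun T => H1.exists_repr (m T)
  have hsum : ∀ {F : Type} [NormedAddCommGroup F] [NormedSpace ℝ F]
      (f : ∀ T : 𝒯.cells, L2 (element T.1) F) (_ : ∀ T, ‖f T‖ ≤ ‖m T‖),
      ‖∑ T, extendL2 F Ω.toOpens (f T)‖ ≤ Fintype.card 𝒯.cells * ‖l‖ := by
    intro F _ _ f hf
    rw [← nsmul_eq_mul, ← Finset.card_univ, ← Finset.sum_const]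
    exact (norm_sum_le _ _).trans (Finset.sum_le_sum fun T _ =>
      (norm_extendL2_le F _ _).trans ((hf T).trans (hm T)))
  -- The witnesses are the sums over the cells of the local representers extended by zero.
  refine ⟨_, _, hsum a ha, hsum g hg, ?_⟩
  ext v
  rw [_root_.add_apply, pairVal_eq_sum, pairGrad_eq_sum, ← Finset.sum_add_distrib, hml]
  refine Finset.sum_congr rfl fun T _ => ?_
  rw [𝒯.restrictL2_sum_extendL2, 𝒯.restrictL2_sum_extendL2]
  exact hag T (v T)

end Mesh

/-! ### The trial space and the kernel of B. -/

section Operators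

variable {d : ℕ} {Ω : LipschitzDomain d}

/-- The element `(u, σ, q, r)` of `U`. -/
def TrialSpace.mk (𝒯 : Triangulation Ω) (u : H10 Ω.toOpens) (σ : Trace 𝒯)
    (q r : L2 Ω.toOpens ℝ) : TrialSpace 𝒯 := (u, σ, q, r)

lemma TrialSpace.norm_le (𝒯 : Triangulation Ω) (w : TrialSpace 𝒯) :
    ‖w‖ ≤ ‖H10.grad Ω.toOpens (TrialSpace.u 𝒯 w)‖ + traceNorm 𝒯 (TrialSpace.σ 𝒯 w) +
      ‖TrialSpace.q 𝒯 w‖ + ‖TrialSpace.r 𝒯 w‖ := by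
  rw [TrialSpace.norm_def]
  have h1 := norm_nonneg (H10.grad Ω.toOpens (TrialSpace.u 𝒯 w))
  have h2 := traceNorm_nonneg 𝒯 (TrialSpace.σ 𝒯 w)
  have h3 := norm_nonneg (TrialSpace.q 𝒯 w)
  have h4 := norm_nonneg (TrialSpace.r 𝒯 w)
  rw [Real.sqrt_le_left (by positivity)]
  nlinarith [mul_nonneg h1 h2, mul_nonneg h1 h3, mul_nonneg h1 h4, mul_nonneg h2 h3,
    mul_nonneg h2 h4, mul_nonneg h3 h4]

lemma TrialSpace.norm_grad_u_le (𝒯 : Triangulation Ω) (w : TrialSpace 𝒯) :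
    ‖H10.grad Ω.toOpens (TrialSpace.u 𝒯 w)‖ ≤ ‖w‖ := by
  refine Real.le_sqrt_of_sq_le ?_
  nlinarith [sq_nonneg (traceNorm 𝒯 (TrialSpace.σ 𝒯 w)),
    sq_nonneg ‖TrialSpace.q 𝒯 w‖, sq_nonneg ‖TrialSpace.r 𝒯 w‖]

lemma TrialSpace.traceNorm_σ_le (𝒯 : Triangulation Ω) (w : TrialSpace 𝒯) :
    traceNorm 𝒯 (TrialSpace.σ 𝒯 w) ≤ ‖w‖ := by
  refine Real.le_sqrt_of_sq_le ?_
  nlinarith [sq_nonneg ‖H10.grad Ω.toOpens (TrialSpace.u 𝒯 w)‖,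
    sq_nonneg ‖TrialSpace.q 𝒯 w‖, sq_nonneg ‖TrialSpace.r 𝒯 w‖]

lemma TrialSpace.norm_q_le (𝒯 : Triangulation Ω) (w : TrialSpace 𝒯) :
    ‖TrialSpace.q 𝒯 w‖ ≤ ‖w‖ := by
  refine Real.le_sqrt_of_sq_le ?_
  nlinarith [sq_nonneg ‖H10.grad Ω.toOpens (TrialSpace.u 𝒯 w)‖,
    sq_nonneg (traceNorm 𝒯 (TrialSpace.σ 𝒯 w)), sq_nonneg ‖TrialSpace.r 𝒯 w‖]

lemma TrialSpace.norm_r_le (𝒯 : Triangulation Ω) (w : TrialSpace 𝒯) :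
    ‖TrialSpace.r 𝒯 w‖ ≤ ‖w‖ := by
  refine Real.le_sqrt_of_sq_le ?_
  nlinarith [sq_nonneg ‖H10.grad Ω.toOpens (TrialSpace.u 𝒯 w)‖,
    sq_nonneg (traceNorm 𝒯 (TrialSpace.σ 𝒯 w)), sq_nonneg ‖TrialSpace.q 𝒯 w‖]

lemma TrialSpace.ext_components (𝒯 : Triangulation Ω) {w w' : TrialSpace 𝒯}
    (h1 : TrialSpace.u 𝒯 w = TrialSpace.u 𝒯 w') (h2 : TrialSpace.σ 𝒯 w = TrialSpace.σ 𝒯 w')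
    (h3 : TrialSpace.q 𝒯 w = TrialSpace.q 𝒯 w') (h4 : TrialSpace.r 𝒯 w = TrialSpace.r 𝒯 w') :
    w = w' := Prod.ext h1 (Prod.ext h2 (Prod.ext h3 h4))

lemma norm_flux_le (κ : Coefficient Ω) (β : Space d) (u : H10 Ω.toOpens) (q : L2 Ω.toOpens ℝ) :
    ‖flux κ β u q‖ ≤ ‖mulCoeff κ‖ * ‖H10.grad Ω.toOpens u‖ + ‖mulVec Ω β‖ * ‖q‖ :=
  norm_add_le_of_le (ContinuousLinearMap.le_opNorm _ _) (ContinuousLinearMap.le_opNorm _ _)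

/-- `u` solves the primal problem if and only if `div (κ∇u + q β) = r`. -/
lemma solvesPrimal_iff {κ : Coefficient Ω} {β : Space d} {q r : L2 Ω.toOpens ℝ}
    {u : H10 Ω.toOpens} :
    SolvesPrimal κ β q r u ↔ IsWeakDivergence Ω.toOpens (flux κ β u q) r := by
  rw [isWeakDivergence_iff_H10]
  refine forall_congr' fun v => ?_
  rw [flux, inner_add_left]
  constructor <;> intro h <;> linarith

/-- The pair `(τ, δ)` with `δ = div τ`, as an element of `H(div, ω)`. -/
def HDiv.mk {ω : Opens (Space d)} {τ : L2 ω (Space d)} {δ : L2 ω ℝ}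
    (h : IsWeakDivergence ω τ δ) : HDiv ω := ⟨WithLp.toLp 2 (τ, δ), h⟩

lemma trn_mk (𝒯 : Triangulation Ω) {τ : L2 Ω.toOpens (Space d)} {δ : L2 Ω.toOpens ℝ}
    (h : IsWeakDivergence Ω.toOpens τ δ) :
    trn 𝒯 (HDiv.mk h) = pairVal 𝒯 δ + pairGrad 𝒯 τ := rfl

lemma HDiv.div_eq {ω : Opens (Space d)} {τ : HDiv ω} {δ : L2 ω ℝ}
    (h : IsWeakDivergence ω (HDiv.val ω τ) δ) : HDiv.div ω τ = δ :=
  IsWeakDivergence.unique (τ := HDiv.val ω τ) τ.2 h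

/-- Normal traces vanish on `H^1_0(Ω)`. -/
lemma trn_toBroken_H10 (𝒯 : Triangulation Ω) (τ : HDiv Ω.toOpens) (v : H10 Ω.toOpens) :
    trn 𝒯 τ (toBroken 𝒯 v) = 0 := by
  change (pairVal 𝒯 (HDiv.div Ω.toOpens τ) + pairGrad 𝒯 (HDiv.val Ω.toOpens τ)) _ = 0
  rw [_root_.add_apply, pairVal_toBroken, pairGrad_toBroken]
  have h := (isWeakDivergence_iff_H10 (τ := HDiv.val Ω.toOpens τ)
    (δ := HDiv.div Ω.toOpens τ)).1 τ.2 v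
  change _ + inner ℝ _ (H10.grad Ω.toOpens v) = 0
  rw [h]
  exact add_neg_cancel _

lemma B_apply (𝒯 : Triangulation Ω) (κ : Coefficient Ω) (β : Space d) (w : TrialSpace 𝒯) :
    B 𝒯 κ β w = pairGrad 𝒯 (flux κ β (TrialSpace.u 𝒯 w) (TrialSpace.q 𝒯 w)) -
      (TrialSpace.σ 𝒯 w : TestDual 𝒯) + pairVal 𝒯 (TrialSpace.r 𝒯 w) := rfl

/-- This identifies the kernel of B with the graph of ℰ. It also replaces the definition of ℰ by
conditions that are visibly linear in w. -/
lemma isE_iff {𝒯 : Triangulation Ω} {κ : Coefficient Ω} {β : Space d} {q r : L2 Ω.toOpens ℝ}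
    {w : TrialSpace 𝒯} : IsE 𝒯 κ β q r w ↔
      B 𝒯 κ β w = 0 ∧ TrialSpace.q 𝒯 w = q ∧ TrialSpace.r 𝒯 w = r := by
  constructor
  · rintro ⟨hu, ⟨τ, hτ, hσ⟩, rfl, rfl⟩
    refine ⟨?_, rfl, rfl⟩
    rw [solvesPrimal_iff, ← hτ] at hu
    rw [B_apply, ← hσ, ← hτ, ← HDiv.div_eq hu]
    change _ - (pairVal 𝒯 (HDiv.div Ω.toOpens τ) + pairGrad 𝒯 (HDiv.val Ω.toOpens τ)) + _ = 0
    abel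
  · rintro ⟨hB, rfl, rfl⟩
    obtain ⟨τ, hτ⟩ := (TrialSpace.σ 𝒯 w).2
    have hdiv : IsWeakDivergence Ω.toOpens (flux κ β (TrialSpace.u 𝒯 w) (TrialSpace.q 𝒯 w))
        (TrialSpace.r 𝒯 w) := by
      rw [isWeakDivergence_iff_H10]
      intro v
      -- Testing on H^1_0(Ω) removes the trace term, leaving the statement that the flux has
      -- divergence r.
      have h := congrArg (fun l : TestDual 𝒯 => l (toBroken 𝒯 v)) hB
      simp only [B_apply, ← hτ, _root_.add_apply, _root_.sub_apply, _root_.zero_apply,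
        pairGrad_toBroken, pairVal_toBroken, trn_toBroken_H10] at h
      change inner ℝ _ (H10.grad Ω.toOpens v) - 0 + inner ℝ _ (H10.val Ω.toOpens v) = 0 at h
      linarith
    refine ⟨solvesPrimal_iff.2 hdiv, ⟨HDiv.mk hdiv, rfl, ?_⟩, rfl, rfl⟩
    -- Now that r is the divergence of the flux, the first and last terms of B w are together the
    -- trace of the flux, so B w = 0 says that σ is this trace.
    rw [trn_mk]
    rw [B_apply] at hB
    rw [← sub_eq_zero, ← hB]
    abel

lemma exists_isE (hd : 2 ≤ d) (𝒯 : Triangulation Ω) {κ : Coefficient Ω}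
    (hκ : κ.IsUniformlyPosDef) (β : Space d) (q r : L2 Ω.toOpens ℝ) :
    ∃ w : TrialSpace 𝒯, IsE 𝒯 κ β q r w := by
  obtain ⟨u, hu⟩ := exists_weak_solution hd hκ (-mulVec Ω β q) (-r)
  have hs : SolvesPrimal κ β q r u := fun v => by
    rw [hu v, inner_neg_left, inner_neg_left, sub_eq_add_neg]
  have hdiv := solvesPrimal_iff.1 hs
  exact ⟨TrialSpace.mk 𝒯 u ⟨trn 𝒯 (HDiv.mk hdiv), _, rfl⟩ q r, hs, ⟨_, rfl, rfl⟩, rfl, rfl⟩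

end Operators


/-! ### Boundedness of ℰ and B, and the right inverse of B. -/

section Operators

variable {d : ℕ} {Ω : LipschitzDomain d}

local instance (𝒯 : Triangulation Ω) : SeminormedAddCommGroup (TestSpace 𝒯) :=
  PiLp.seminormedAddCommGroup 2 _

local instance (𝒯 : Triangulation Ω) : NormedSpace ℝ (TestSpace 𝒯) :=
  PiLp.normedSpace 2 ℝ _

local instance (𝒯 : Triangulation Ω) : SeminormedAddCommGroup (TestDual 𝒯) :=
  ContinuousLinearMap.toSeminormedAddCommGroup

local instance (𝒯 : Triangulation Ω) : NormedSpace ℝ (TestDual 𝒯) :=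
  ContinuousLinearMap.toNormedSpace

local instance (𝒯 : Triangulation Ω) : AddCommGroup (Trace 𝒯) :=
  Submodule.addCommGroup _

/-- The arithmetic of the bound for `ℰ`. -/
lemma energy_bound {C M K x y z G F t n : ℝ} (hC : 0 ≤ C) (hM : 0 ≤ M) (hK : 0 ≤ K)
    (hx : 0 ≤ x) (hy : 0 ≤ y) (h1 : G ≤ C * (z + y)) (h2 : z ≤ M * x) (h3 : F ≤ K * G + M * x)
    (h4 : t ≤ F + y) (h5 : n ≤ G + t + x + y) :
    n ≤ ((1 + K) * (C * (M + 1)) + M + 2) * (x + y) := by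
  have h6 : G ≤ C * (M + 1) * (x + y) := by
    refine h1.trans ?_
    rw [mul_assoc]
    refine mul_le_mul_of_nonneg_left ?_ hC
    nlinarith [mul_nonneg hM hy]
  have h7 : K * G ≤ K * (C * (M + 1) * (x + y)) := mul_le_mul_of_nonneg_left h6 hK
  nlinarith [mul_nonneg hM hy]

/-- The energy estimate bounds ∇u by q and r. The flux is an admissible representative of σ and has
divergence r, so its H(div) norm bounds the trace norm. -/
lemma exists_norm_le_of_isE (hd : 2 ≤ d) (𝒯 : Triangulation Ω) {κ : Coefficient Ω}
    (hκ : κ.IsUniformlyPosDef) (β : Space d) :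
    ∃ C : ℝ, ∀ (q r : L2 Ω.toOpens ℝ) (w : TrialSpace 𝒯), IsE 𝒯 κ β q r w →
      ‖w‖ ≤ C * (‖q‖ + ‖r‖) := by
  obtain ⟨C, hC, hE⟩ := exists_norm_grad_le hd hκ
  refine ⟨(1 + ‖mulCoeff κ‖) * (C * (‖mulVec Ω β‖ + 1)) + ‖mulVec Ω β‖ + 2, ?_⟩
  rintro q r w ⟨hs, ⟨τ, hτ, hσ⟩, rfl, rfl⟩
  have h1 := hE (-mulVec Ω β (TrialSpace.q 𝒯 w)) (-TrialSpace.r 𝒯 w) (TrialSpace.u 𝒯 w)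
    (fun v => by rw [hs v, inner_neg_left, inner_neg_left, sub_eq_add_neg])
  rw [norm_neg, norm_neg] at h1
  have h4 := (traceNorm_le 𝒯 _ τ hσ).trans (HDiv.norm_le τ)
  rw [solvesPrimal_iff, ← hτ] at hs
  rw [hτ, HDiv.div_eq hs] at h4
  exact energy_bound hC (mulVec Ω β).opNorm_nonneg (mulCoeff κ).opNorm_nonneg (norm_nonneg _)
    (norm_nonneg _) h1 ((mulVec Ω β).le_opNorm _) (norm_flux_le κ β _ _) h4
    (TrialSpace.norm_le 𝒯 w)

lemma SolvesPrimal.unique (hd : 2 ≤ d) {κ : Coefficient Ω} (hκ : κ.IsUniformlyPosDef)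
    {β : Space d} {q r : L2 Ω.toOpens ℝ} {u u' : H10 Ω.toOpens}
    (h : SolvesPrimal κ β q r u) (h' : SolvesPrimal κ β q r u') : u = u' := by
  obtain ⟨C, -, hE⟩ := exists_norm_grad_le hd hκ
  rw [← sub_eq_zero]
  refine H10.eq_zero_of_grad_eq_zero hd (norm_le_zero_iff.1 ?_)
  refine (hE 0 0 (u - u') fun v => ?_).trans_eq (by rw [norm_zero, norm_zero]; ring)
  rw [map_sub, map_sub, inner_sub_left, h v, h' v, inner_zero_left, inner_zero_left]
  ring

/-- The solution u is unique, hence so is the flux; its divergence is determined by it, so the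
element of H(div) whose trace is taken is unique as well. -/
lemma isE_unique (hd : 2 ≤ d) {𝒯 : Triangulation Ω} {κ : Coefficient Ω}
    (hκ : κ.IsUniformlyPosDef) {β : Space d} {q r : L2 Ω.toOpens ℝ} {w w' : TrialSpace 𝒯}
    (h : IsE 𝒯 κ β q r w) (h' : IsE 𝒯 κ β q r w') : w = w' := by
  obtain ⟨hu, ⟨τ, hτ, hσ⟩, hq, hr⟩ := h
  obtain ⟨hu', ⟨τ', hτ', hσ'⟩, hq', hr'⟩ := h'
  have huu := hu.unique hd hκ hu'
  refine TrialSpace.ext_components 𝒯 huu (Subtype.ext ?_) (hq.trans hq'.symm) (hr.trans hr'.symm)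
  have hdiv := solvesPrimal_iff.1 hu
  have hdiv' := hdiv
  rw [← hτ] at hdiv
  rw [huu, ← hτ'] at hdiv'
  have hv : τ = τ' := by
    refine Subtype.ext (WithLp.ofLp_injective 2 (Prod.ext ?_ ?_))
    · exact hτ.trans ((congrArg (flux κ β · q) huu).trans hτ'.symm)
    · exact (HDiv.div_eq hdiv).trans (HDiv.div_eq hdiv').symm
  rw [← hσ, ← hσ', hv]

/-- The operator `ℰ : L_2(Ω) × L_2(Ω) → U`. -/
lemma exists_operatorE (hd : 2 ≤ d) (𝒯 : Triangulation Ω) {κ : Coefficient Ω}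
    (hκ : κ.IsUniformlyPosDef) (β : Space d) :
    ∃ E : L2 Ω.toOpens ℝ × L2 Ω.toOpens ℝ →L[ℝ] TrialSpace 𝒯,
      ∀ (q r : L2 Ω.toOpens ℝ) (w : TrialSpace 𝒯), IsE 𝒯 κ β q r w ↔ w = E (q, r) := by
  choose E hE using fun p : L2 Ω.toOpens ℝ × L2 Ω.toOpens ℝ => exists_isE hd 𝒯 hκ β p.1 p.2
  obtain ⟨C, hC⟩ := exists_norm_le_of_isE hd 𝒯 hκ β
  have hE' := fun p => isE_iff.1 (hE p)
  let E₀ : L2 Ω.toOpens ℝ × L2 Ω.toOpens ℝ →ₗ[ℝ] TrialSpace 𝒯 :=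
    { toFun := E
      -- The values of `E` were chosen pointwise. Linearity follows because sums and multiples stay
      -- in the kernel of B with the right last two components, and uniqueness applies.
      map_add' := fun x y => isE_unique hd hκ (hE _) <| isE_iff.2 <| by
        rw [map_add, map_add, map_add, (hE' x).1, (hE' y).1, (hE' x).2.1, (hE' y).2.1,
          (hE' x).2.2, (hE' y).2.2]
        exact ⟨add_zero _, rfl, rfl⟩
      map_smul' := fun c x => isE_unique hd hκ (hE _) <| isE_iff.2 <| by
        rw [RingHom.id_apply, map_smul, map_smul, map_smul, (hE' x).1, (hE' x).2.1, (hE' x).2.2]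
        exact ⟨smul_zero _, rfl, rfl⟩ }
  -- The product of the two L_2 spaces carries the maximum norm, which accounts for the factor 2;
  -- the absolute value is there because no sign of C is known.
  refine ⟨E₀.mkContinuous (|C| * 2) fun p => ?_, fun q r w => ⟨fun h => ?_, ?_⟩⟩
  · refine (hC p.1 p.2 _ (hE p)).trans ?_
    rw [mul_assoc]
    have h1 := norm_fst_le p
    have h2 := norm_snd_le p
    refine mul_le_mul (le_abs_self C) (by linarith) (by positivity) (abs_nonneg C)
  · exact isE_unique hd hκ h (hE (q, r))
  · rintro rfl
    exact hE (q, r)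

/-- In the summand 3, the trace term contributes 2 and the term with r contributes 1. -/
lemma norm_B_le (𝒯 : Triangulation Ω) (κ : Coefficient Ω) (β : Space d) (w : TrialSpace 𝒯) :
    ‖B 𝒯 κ β w‖ ≤ Fintype.card 𝒯.cells * (‖mulCoeff κ‖ + ‖mulVec Ω β‖ + 3) * ‖w‖ := by
  set N : ℝ := (Fintype.card 𝒯.cells : ℝ) with hN
  have hN0 : 0 ≤ N := Nat.cast_nonneg _
  have h1 := norm_pairGrad_le 𝒯 (flux κ β (TrialSpace.u 𝒯 w) (TrialSpace.q 𝒯 w))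
  have h2 := norm_flux_le κ β (TrialSpace.u 𝒯 w) (TrialSpace.q 𝒯 w)
  have h3 := norm_le_traceNorm 𝒯 (TrialSpace.σ 𝒯 w)
  have h4 := norm_pairVal_le 𝒯 (TrialSpace.r 𝒯 w)
  have h5 := mul_le_mul_of_nonneg_left (TrialSpace.norm_grad_u_le 𝒯 w) (mulCoeff κ).opNorm_nonneg
  have h6 := mul_le_mul_of_nonneg_left (TrialSpace.norm_q_le 𝒯 w) (mulVec Ω β).opNorm_nonneg
  have h7 := mul_le_mul_of_nonneg_left (TrialSpace.traceNorm_σ_le 𝒯 w) hN0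
  have h8 := mul_le_mul_of_nonneg_left (TrialSpace.norm_r_le 𝒯 w) hN0
  have h9 := mul_le_mul_of_nonneg_left (h2.trans (add_le_add h5 h6)) hN0
  rw [← hN] at h1 h3 h4
  have h10 : ‖B 𝒯 κ β w‖ ≤ _ := norm_add_le_of_le (norm_sub_le_of_le h1 h3) h4
  linarith

/-- The arithmetic for the right inverse: F is the norm of κ∇u - g, t a trace norm, and z the norm
of the zero function, which occurs both as the divergence and as q. -/
lemma right_inverse_bound {C K N l G F t z y n : ℝ} (h1 : G ≤ C * (N * l))
    (h2 : F ≤ K * (C * (N * l)) + N * l) (h3 : t ≤ F + z) (h4 : z = 0) (h5 : y ≤ N * l)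
    (h6 : n ≤ G + t + z + y) : n ≤ ((1 + K) * (C * N) + 2 * N) * l := by
  linarith

/-- `B` has a bounded right inverse. -/
lemma exists_B_eq (hd : 2 ≤ d) (𝒯 : Triangulation Ω) {κ : Coefficient Ω}
    (hκ : κ.IsUniformlyPosDef) (β : Space d) :
    ∃ C : ℝ, ∀ l : TestDual 𝒯, ∃ w : TrialSpace 𝒯, B 𝒯 κ β w = l ∧ ‖w‖ ≤ C * ‖l‖ := by
  obtain ⟨C, hC, hE⟩ := exists_norm_grad_le hd hκ
  refine ⟨(1 + ‖mulCoeff κ‖) * (C * Fintype.card 𝒯.cells) + 2 * Fintype.card 𝒯.cells,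
    fun l => ?_⟩
  obtain ⟨a, g, ha, hg, hl⟩ := exists_repr 𝒯 l
  -- This choice makes κ∇u - g divergence free, so its normal trace is the functional v ↦ (κ∇u - g,
  -- ∇v)_𝒯. Subtracting it from (κ∇u, ∇v)_𝒯 leaves (g, ∇v)_𝒯, and r = a supplies the rest.
  obtain ⟨u, hu⟩ := exists_weak_solution hd hκ g 0
  have hdiv : IsWeakDivergence Ω.toOpens (mulCoeff κ (H10.grad Ω.toOpens u) - g) 0 := by
    rw [isWeakDivergence_iff_H10]
    intro v
    rw [inner_sub_left, hu v]
    simp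
  refine ⟨TrialSpace.mk 𝒯 u ⟨trn 𝒯 (HDiv.mk hdiv), _, rfl⟩ 0 a, ?_, ?_⟩
  · change pairGrad 𝒯 (mulCoeff κ (H10.grad Ω.toOpens u) + mulVec Ω β 0) -
      trn 𝒯 (HDiv.mk hdiv) + pairVal 𝒯 a = l
    rw [trn_mk, map_zero, map_zero, map_sub, add_zero, hl]
    abel
  · have h1 : ‖H10.grad Ω.toOpens u‖ ≤ C * (Fintype.card 𝒯.cells * ‖l‖) := by
      refine (hE g 0 u hu).trans ?_
      rw [norm_zero, add_zero]
      exact mul_le_mul_of_nonneg_left hg hC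
    have h2 := (traceNorm_le 𝒯 ⟨trn 𝒯 (HDiv.mk hdiv), _, rfl⟩ (HDiv.mk hdiv) rfl).trans
      (HDiv.norm_le _)
    have h3 := ((mulCoeff κ).le_opNorm (H10.grad Ω.toOpens u)).trans
      (mul_le_mul_of_nonneg_left h1 (mulCoeff κ).opNorm_nonneg)
    have h4 := (norm_sub_le (mulCoeff κ (H10.grad Ω.toOpens u)) g).trans (add_le_add h3 hg)
    exact right_inverse_bound h1 h4 h2 norm_zero ha (TrialSpace.norm_le 𝒯
      (TrialSpace.mk 𝒯 u ⟨trn 𝒯 (HDiv.mk hdiv), _, rfl⟩ 0 a))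

end Operators

/-! ### The induced isomorphism on the quotient. -/

/-- A bounded linear map to the dual of a Hilbert sum that has a bounded right inverse induces a
linear homeomorphism of the quotient by its kernel. -/
lemma exists_quotient_equiv {U ι : Type*} [Fintype ι] {E : ι → Type*}
    [SeminormedAddCommGroup U] [NormedSpace ℝ U] [∀ i, NormedAddCommGroup (E i)]
    [∀ i, NormedSpace ℝ (E i)] (f : U →ₗ[ℝ] (PiLp 2 E →L[ℝ] ℝ)) {C C' : ℝ}
    (hf : ∀ u, ‖f u‖ ≤ C * ‖u‖) (h : ∀ w, ∃ u, f u = w ∧ ‖u‖ ≤ C' * ‖w‖) :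
    ∃ Φ : (U ⧸ LinearMap.ker f) ≃L[ℝ] (PiLp 2 E →L[ℝ] ℝ),
      ∀ u, Φ (Submodule.Quotient.mk u) = f u := by
  have hsurj : Function.Surjective f := fun w => (h w).imp fun _ hu => hu.1
  refine ⟨{ f.quotKerEquivOfSurjective hsurj with
    continuous_toFun := ?_
    continuous_invFun := ?_ }, fun u => rfl⟩
  · exact (Submodule.isQuotientMap_mkQ _).continuous_iff.2 (f.mkContinuous C hf).continuous
  -- The inverse sends w to the class of any preimage. The quotient norm of the class is at most the
  -- norm of the preimage supplied by `h`, so completeness of U plays no role.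
  · refine AddMonoidHomClass.continuous_of_bound
      (f.quotKerEquivOfSurjective hsurj).symm C' fun w => ?_
    obtain ⟨u, rfl, hu⟩ := h w
    have : (f.quotKerEquivOfSurjective hsurj).symm (f u) = Submodule.Quotient.mk u := by
      rw [LinearEquiv.symm_apply_eq]
      rfl
    rw [this]
    exact (Submodule.Quotient.norm_mk_le _ u).trans hu

set_option maxHeartbeats 400000 in
lemma exists_quotient_equiv_B {d : ℕ} {Ω : LipschitzDomain d} (hd : 2 ≤ d)
    (𝒯 : Triangulation Ω) {κ : Coefficient Ω} (hκ : κ.IsUniformlyPosDef) (β : Space d) :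
    ∃ Φ : (TrialSpace 𝒯 ⧸ LinearMap.ker (B 𝒯 κ β)) ≃L[ℝ] TestDual 𝒯,
      ∀ w : TrialSpace 𝒯, Φ (Submodule.Quotient.mk w) = B 𝒯 κ β w := by
  obtain ⟨C, hC⟩ := exists_B_eq hd 𝒯 hκ β
  obtain ⟨C', hC'⟩ : ∃ C' : ℝ, ∀ w : TrialSpace 𝒯, ‖B 𝒯 κ β w‖ ≤ C' * ‖w‖ :=
    ⟨_, norm_B_le 𝒯 κ β⟩
  exact exists_quotient_equiv (B 𝒯 κ β) hC' hC

end DPG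

end

/-! ### The proposition. -/

theorem proposition2p2 {d : ℕ} (hd : d = 2 ∨ d = 3) (Ω : DPG.LipschitzDomain d)
    (𝒯 : DPG.Triangulation Ω) (κ : DPG.Coefficient Ω) (hκ : κ.IsSymm)
    (hκ' : κ.IsUniformlyPosDef) (β : DPG.Space d) :
    (∃ E : DPG.L2 Ω.toOpens ℝ × DPG.L2 Ω.toOpens ℝ →L[ℝ] DPG.TrialSpace 𝒯,
      (∀ (q r : DPG.L2 Ω.toOpens ℝ) (w : DPG.TrialSpace 𝒯),
        DPG.IsE 𝒯 κ β q r w ↔ w = E (q, r)) ∧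
      (∃ C : ℝ, ∀ q r : DPG.L2 Ω.toOpens ℝ, ‖E (q, r)‖ ≤ C * (‖q‖ + ‖r‖)) ∧
      Set.range E = (LinearMap.ker (DPG.B 𝒯 κ β) : Set (DPG.TrialSpace 𝒯))) ∧
    ∃ Φ : (DPG.TrialSpace 𝒯 ⧸ LinearMap.ker (DPG.B 𝒯 κ β)) ≃L[ℝ] DPG.TestDual 𝒯,
      ∀ w : DPG.TrialSpace 𝒯, Φ (Submodule.Quotient.mk w) = DPG.B 𝒯 κ β w := by
  have hd' : 2 ≤ d := by omega
  constructor
  · obtain ⟨E, hE⟩ := DPG.exists_operatorE hd' 𝒯 hκ' β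
    obtain ⟨C, hC⟩ := DPG.exists_norm_le_of_isE hd' 𝒯 hκ' β
    refine ⟨E, hE, ⟨C, fun q r => hC q r _ ((hE q r _).2 rfl)⟩, ?_⟩
    ext w
    constructor
    · rintro ⟨⟨q, r⟩, rfl⟩
      exact (DPG.isE_iff.1 ((hE q r _).2 rfl)).1
    · intro hw
      -- A kernel element is the image under ℰ of its own last two components.
      exact ⟨(_, _), ((hE _ _ w).1 (DPG.isE_iff.2 ⟨hw, rfl, rfl⟩)).symm⟩
  · exact DPG.exists_quotient_equiv_B hd' 𝒯 hκ' β
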